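/- For $d\ge 2$ let $\delta_s x=(sx_1,s^2x_2,\dots,s^dx_d)$ ($s>0$) be the parabolic dilations of $\mathbb R^d$. Let $n\ge 1$ be the integer with $2^{n-1}<d\le 2^n$ and put $$\rho(x)=\sum_{l=0}^{n}\Big(\sum_{2^{l-1}<j\le 2^l,\ j\le d}|x_j|^{2^l/j}\Big)^{1/2^l}.$$ Let $P^\rho(x)=\int_{\mathbb R^d}e^{-\rho(\xi)}e^{2\pi i\xi\cdot x}\,d\xi$ be the Poisson kernel associated with $\rho$ (the function with Fourier transform $e^{-\rho}$). Let $\sigma$ be the probability measure on $\mathbb R^d$ given by $\int\phi\,d\sigma=\int_{1/2<|t|\le 1}\phi(t,t^2,\dots,t^d)\,dt$, and let $\nu$ be the signed measure $d\nu=d\sigma-P^\rho(x)\,dx$. For $s>0$ let $\nu_s$ be its parabolic dilate, $\int\phi\,d\nu_s=\int\phi(\delta_s x)\,d\nu(x)$, and for $f\in L^2(\mathbb R^d)$ let $$S f(x)=\Big(\sum_{k\in\mathbb Z}|(f*\nu_{2^k})(x)|^2\Big)^{1/2},\qquad (f*\nu_{2^k})(x)=\int f(x-y)\,d\nu_{2^k}(y).$$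 Theorem. There is an absolute constant $c>0$ such that for every $d\ge 2$ and every $f\in L^2(\mathbb R^d)$ (complex valued) the integrals defining $(f*\nu_{2^k})(x)$, $k\in\mathbb Z$, converge absolutely for almost every $x$, the function $Sf$ is measurable (up to a null set), and $$\|S f\|_{L^2(\mathbb R^d)}\le c\,\log d\;\|f\|_{L^2(\mathbb R^d)}.$$ -/

import Mathlib

open MeasureTheory
open scoped ENNReal FourierTransform

noncomputable section

namespace ParabolicSquare

/-- `ℝ^d`. The coordinate written `x_j` (`1 ≤ j ≤ d`) in mathematics is `x i` with `j = i + 1`. -/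
abbrev E (d : ℕ) : Type := EuclideanSpace ℝ (Fin d)

/-- The parabolic dilation `δ_s x = (s x_1, s² x_2, …, s^d x_d)`. -/
def dilation {d : ℕ} (s : ℝ) (x : E d) : E d :=
  WithLp.toLp 2 fun i => s ^ ((i : ℕ) + 1) * x i

/-- The parabolic norm: with `2^(n-1) < d ≤ 2^n`, i.e. `n = Nat.clog 2 d`,
`ρ(x) = ∑_{l=0}^n (∑_{2^(l-1) < j ≤ 2^l, j ≤ d} |x_j|^(2^l / j))^(1 / 2^l)`.
The condition `2^(l-1) < j` is written `2^l < 2 * j`. -/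
def parabolicNorm {d : ℕ} (x : E d) : ℝ :=
  ∑ l ∈ Finset.range (Nat.clog 2 d + 1),
    (∑ i ∈ Finset.univ.filter (fun i : Fin d => 2 ^ l < 2 * ((i : ℕ) + 1) ∧ (i : ℕ) + 1 ≤ 2 ^ l),
      |x i| ^ ((2 : ℝ) ^ l / ((i : ℕ) + 1 : ℝ))) ^ (1 / (2 : ℝ) ^ l)

/-- The moment curve `t ↦ (t, t², …, t^d)`. -/
def curve (d : ℕ) (t : ℝ) : E d :=
  WithLp.toLp 2 fun i => t ^ ((i : ℕ) + 1)

/-- The measure `σ` with `∫ φ dσ = ∫_{1/2 < |t| ≤ 1} φ(t, t², …, t^d) dt`. -/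
def sigma (d : ℕ) : Measure (E d) :=
  (volume.restrict {t : ℝ | 1 / 2 < |t| ∧ |t| ≤ 1}).map (curve d)

theorem measurable_curve (d : ℕ) : Measurable (curve d) := by
  unfold curve
  fun_prop

theorem measurable_dilation {d : ℕ} (s : ℝ) : Measurable (dilation (d := d) s) := by
  unfold dilation
  fun_prop

instance isProbabilityMeasure_sigma (d : ℕ) : IsProbabilityMeasure (sigma d) := by
  unfold sigma
  have hset : {t : ℝ | 1 / 2 < |t| ∧ |t| ≤ 1} = Set.Ico (-1) (-(1 / 2)) ∪ Set.Ioc (1 / 2) 1 := by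
    ext t
    simp only [Set.mem_ofPred_eq, Set.mem_union, Set.mem_Ico, Set.mem_Ioc]
    rcases abs_cases t with ⟨h, h'⟩ | ⟨h, h'⟩
    · rw [h]
      constructor
      · exact fun h => Or.inr h
      · rintro (h | h)
        · constructor <;> linarith [h.1, h.2]
        · exact h
    · rw [h]
      constructor
      · exact fun h => Or.inl ⟨by linarith [h.2], by linarith [h.1]⟩
      · rintro (h | h)
        · constructor <;> linarith [h.1, h.2]
        · constructor <;> linarith [h.1, h.2]
  have hvol : volume {t : ℝ | 1 / 2 < |t| ∧ |t| ≤ 1} = 1 := by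
    rw [hset, measure_union _ measurableSet_Ioc, Real.volume_Ico, Real.volume_Ioc,
      ← ENNReal.ofReal_add (by norm_num) (by norm_num)]
    · norm_num
    · rw [Set.disjoint_left]
      intro t h1 h2
      linarith [h1.2, h2.1]
  have : IsProbabilityMeasure (volume.restrict {t : ℝ | 1 / 2 < |t| ∧ |t| ≤ 1}) :=
    ⟨by rw [Measure.restrict_apply_univ, hvol]⟩
  exact Measure.isProbabilityMeasure_map (measurable_curve d).aemeasurable

/-- The Poisson kernel `P^ρ(x) = ∫ e^{-ρ(ξ)} e^{2πi ξ·x} dξ`, i.e. the function whose Fourier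
transform is `e^{-ρ}`. The integral is real since `ρ` is even. -/
def poissonKernel (d : ℕ) (x : E d) : ℝ :=
  (𝓕⁻ (fun ξ : E d => (Real.exp (-parabolicNorm ξ) : ℂ)) x).re

/-- The signed measure `dν = dσ - P^ρ(x) dx`. -/
def nu (d : ℕ) : SignedMeasure (E d) :=
  (sigma d).toSignedMeasure - (volume : Measure (E d)).withDensityᵥ (poissonKernel d)

/-- The parabolic dilate `μ_s` of a signed measure: `∫ φ dμ_s = ∫ φ(δ_s x) dμ(x)`. -/
def dilate {d : ℕ} (s : ℝ) (μ : SignedMeasure (E d)) : SignedMeasure (E d) :=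
  μ.map (dilation s)

/-- The convolution `(f * μ)(x) = ∫ f(x - y) dμ(y)` of a function and a signed measure. -/
def conv {d : ℕ} (f : E d → ℂ) (μ : SignedMeasure (E d)) (x : E d) : ℂ :=
  μ.integral (fun y => f (x - y)) (ContinuousLinearMap.lsmul ℝ ℝ).flip

/-- The square function `S f (x) = (∑_{k ∈ ℤ} |(f * ν_{2^k})(x)|²)^{1/2}`, with values in
`[0, ∞]`. -/
def squareFunction {d : ℕ} (f : E d → ℂ) (x : E d) : ℝ≥0∞ :=
  (∑' k : ℤ, ‖conv f (dilate ((2 : ℝ) ^ k) (nu d)) x‖ₑ ^ 2) ^ (1 / 2 : ℝ)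

end ParabolicSquare

end

/-! By Plancherel the theorem reduces to a bound for `∑_k |m(δ_{2^k} ξ)|²`, uniform in `ξ`, where `m
= σ̂ - e^{-ρ}`; a bound of order `log² d` is needed.

Write `ρ = ∑_l r_l`, with one block norm `r_l` for each dyadic range of indices. The key estimate is
`|m| ≤ 340 ∑_l g(r_l)` with `g(r) = min(r, 1, (D/r)^{1/8})` and `D = d^8`
(`norm_curveIntegral_sub_exp_le`). Each `r_l` is homogeneous of degree one under the dilations, so
`∑_k g(2^k r_l)` is a scalar sum of size `O(log d)`: geometric tails on both sides of the `O(log d)`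
scales between `1` and `D`. There are `O(log d)` blocks, and `|m|² ≤ 2|m|` because `|m| ≤ 2`, so the
square sum is `O(log² d)`.

The key estimate needs decay of `σ̂` that is only polynomial in `d`. Take the highest block `l` with
`r_l > D`. Higher blocks are small and can be deleted by the Lipschitz bound. What is left is an
oscillatory integral whose phase has degree at most `N = 2^l` and a coefficient of some degree `j >
N/2` of size at least `(r_l/2)^j`. A smoothed van der Corput argument reduces it to sublevel sets of
the derivative, which are controlled by the Mahler measure. The Mahler measure dominates each
coefficient up to `2^N`, and `j > N/2` makes the `1/(2N)`-th root a fixed power of `r_l`. The result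
is `O(N r_l^{-1/8})`, and `D^{1/8} = d` absorbs `N ≤ 2d`.

The Poisson kernel must also be shown to be a finite measure with transform `e^{-ρ}`. Since
`|x_j|^{2^l/j}` has exponent below `2`, it is conditionally negative definite; sums and powers in
`(0, 1]` keep this property, so `e^{-ρ}` is positive definite by Schoenberg's theorem. Gaussian
regularisation then shows that its inverse transform is nonnegative and integrable, and Fourier
inversion applies. Thus `ν` is a difference of two finite measures, to which the `L²` multiplier
theory is applied. -/

namespace ParabolicSquare

/-! ### Van der Corput estimates for polynomial phases -/

open Polynomial in
-- Between consecutive roots of `p` the primitive `F` is monotone, so its variation there is at most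
-- `2M`; `n` interior roots leave at most `n + 1` such pieces.
theorem intervalIntegral_abs_mul_eval_le (p : ℝ[X]) (hp : p ≠ 0) {F g : ℝ → ℝ} {M : ℝ}
    (hg : Continuous g) (hg0 : ∀ t, 0 ≤ g t) (hF : ∀ t, HasDerivAt F (g t * p.eval t) t)
    (hM : ∀ t, |F t| ≤ M) (n : ℕ) :
    ∀ a b : ℝ, a ≤ b → (p.roots.toFinset.filter (fun t => a < t ∧ t < b)).card = n →
      ∫ t in a..b, |g t * p.eval t| ≤ 2 * M * (n + 1) := by
  have hc : Continuous fun t => g t * p.eval t := by fun_prop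
  have hM0 : 0 ≤ M := (abs_nonneg _).trans (hM 0)
  induction n using Nat.strong_induction_on with
  | _ n ih =>
    intro a b hab hn
    by_cases hr : ∃ c, a < c ∧ c < b ∧ p.eval c = 0
    · obtain ⟨c, hac, hcb, hc0⟩ := hr
      have hcr : c ∈ p.roots.toFinset := by simp [hp, hc0]
      set s1 := p.roots.toFinset.filter (fun t => a < t ∧ t < c)
      set s2 := p.roots.toFinset.filter (fun t => c < t ∧ t < b)
      have hd : Disjoint s1 s2 := by
        rw [Finset.disjoint_left]
        intro t h1 h2
        simp only [s1, s2, Finset.mem_filter] at h1 h2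
        linarith [h1.2.2, h2.2.1]
      have hcn : c ∉ s1 ∪ s2 := by simp [s1, s2]
      have hsub : insert c (s1 ∪ s2) ⊆ p.roots.toFinset.filter (fun t => a < t ∧ t < b) := by
        intro t ht
        simp only [s1, s2, Finset.mem_insert, Finset.mem_union, Finset.mem_filter] at ht ⊢
        rcases ht with rfl | ⟨h, h1, h2⟩ | ⟨h, h1, h2⟩
        · exact ⟨hcr, hac, hcb⟩
        · exact ⟨h, h1, by linarith⟩
        · exact ⟨h, by linarith, h2⟩
      -- The splitting root `c` lies in neither half; this spare unit pays for the additional piece.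
      have hcard : s1.card + s2.card + 1 ≤ n := by
        rw [← hn, ← Finset.card_union_of_disjoint hd, ← Finset.card_insert_of_notMem hcn]
        exact Finset.card_le_card hsub
      have i1 := ih s1.card (by omega) a c hac.le rfl
      have i2 := ih s2.card (by omega) c b hcb.le rfl
      rw [← intervalIntegral.integral_add_adjacent_intervals
        (hc.abs.intervalIntegrable a c) (hc.abs.intervalIntegrable c b)]
      have : ((s1.card : ℝ) + s2.card + 1) ≤ n := by exact_mod_cast hcard
      nlinarith
    · push Not at hr
      have key : |∫ t in a..b, g t * p.eval t| ≤ 2 * M := by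
        rw [intervalIntegral.integral_eq_sub_of_hasDerivAt (fun t _ => hF t)
          (hc.intervalIntegrable a b)]
        linarith [abs_sub (F b) (F a), hM a, hM b]
      have hsign : (∀ t ∈ Set.Ioo a b, 0 ≤ p.eval t) ∨ (∀ t ∈ Set.Ioo a b, p.eval t ≤ 0) := by
        by_contra hcon
        push Not at hcon
        obtain ⟨⟨x, hx, hx0⟩, ⟨y, hy, hy0⟩⟩ := hcon
        have := (isPreconnected_Ioo (a := a) (b := b)).intermediate_value hx hy
          (p.continuous.continuousOn)
        obtain ⟨z, hz, hz0⟩ := this ⟨hx0.le, hy0.le⟩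
        exact hr z hz.1 hz.2 hz0
      have hle : ∫ t in a..b, |g t * p.eval t| ≤ |∫ t in a..b, g t * p.eval t| := by
        rcases hsign with h | h
        · refine le_trans (le_of_eq ?_) (le_abs_self _)
          rw [intervalIntegral.integral_of_le hab, intervalIntegral.integral_of_le hab,
            integral_Ioc_eq_integral_Ioo, integral_Ioc_eq_integral_Ioo]
          refine setIntegral_congr_fun measurableSet_Ioo fun t ht => ?_
          exact abs_of_nonneg (mul_nonneg (hg0 t) (h t ht))
        · refine le_trans (le_of_eq ?_) (neg_le_abs _)
          rw [← intervalIntegral.integral_neg, intervalIntegral.integral_of_le hab,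
            intervalIntegral.integral_of_le hab,
            integral_Ioc_eq_integral_Ioo, integral_Ioc_eq_integral_Ioo]
          refine setIntegral_congr_fun measurableSet_Ioo fun t ht => ?_
          exact abs_of_nonpos (mul_nonpos_of_nonneg_of_nonpos (hg0 t) (h t ht))
      have : (0 : ℝ) ≤ n := Nat.cast_nonneg n
      nlinarith

open Polynomial in
/-- The total variation of `arctan (h / α) / α` for a polynomial `h`. -/
theorem intervalIntegral_abs_derivative_div_le (h : ℝ[X]) {α : ℝ} (hα : 0 < α) {a b : ℝ}
    (hab : a ≤ b) :
    ∫ t in a..b, |h.derivative.eval t| / (h.eval t ^ 2 + α ^ 2) ≤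
      Real.pi / α * (h.natDegree + 1) := by
  by_cases hp : h.derivative = 0
  · simp only [hp, eval_zero, abs_zero, zero_div, intervalIntegral.integral_zero]
    have := Real.pi_pos
    positivity
  have hpos : ∀ t, 0 < h.eval t ^ 2 + α ^ 2 := fun t => by positivity
  have key := intervalIntegral_abs_mul_eval_le h.derivative hp
    (F := fun t => Real.arctan (h.eval t / α) / α) (g := fun t => (h.eval t ^ 2 + α ^ 2)⁻¹)
    (M := Real.pi / (2 * α)) (by
      refine Continuous.inv₀ (by fun_prop) fun t => (hpos t).ne') (fun t => by positivity)
    (fun t => by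
      have h1 := ((h.hasDerivAt t).div_const α).arctan.div_const α
      refine h1.congr_deriv ?_
      have := hpos t
      field_simp
      ring)
    (fun t => by
      rw [abs_div, abs_of_pos hα, ← div_div]
      gcongr
      rw [abs_le]
      exact ⟨by linarith [Real.neg_pi_div_two_lt_arctan (h.eval t / α)],
        (Real.arctan_lt_pi_div_two _).le⟩) _ a b hab rfl
  calc ∫ t in a..b, |h.derivative.eval t| / (h.eval t ^ 2 + α ^ 2)
      = ∫ t in a..b, |(h.eval t ^ 2 + α ^ 2)⁻¹ * h.derivative.eval t| := by
        refine intervalIntegral.integral_congr fun t _ => ?_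
        simp only [abs_mul, abs_inv, abs_of_pos (hpos t)]
        ring
    _ ≤ _ := key
    _ ≤ Real.pi / α * (h.natDegree + 1) := by
        have : 2 * (Real.pi / (2 * α)) = Real.pi / α := by field_simp
        rw [this]
        have hπ := Real.pi_pos
        gcongr
        calc _ ≤ h.derivative.roots.toFinset.card := Finset.card_filter_le _ _
          _ ≤ Multiset.card h.derivative.roots := Multiset.toFinset_card_le _
          _ ≤ h.derivative.natDegree := card_roots' _
          _ ≤ h.natDegree := (natDegree_derivative_le h).trans (Nat.sub_le _ _)

open Polynomial in
/-- A van der Corput estimate without monotonicity: the oscillatory integral is controlled by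
a smoothed sublevel set of the derivative of the phase. -/
theorem norm_integral_exp_eval_le (Q : ℝ[X]) {α : ℝ} (hα : 0 < α) {a b : ℝ} (hab : a ≤ b) :
    ‖∫ t in a..b, Complex.exp (Q.eval t * Complex.I)‖ ≤
      (∫ t in a..b, α ^ 2 / (Q.derivative.eval t ^ 2 + α ^ 2)) +
        (1 + Real.pi * (Q.derivative.natDegree + 1)) / α := by
  set h := Q.derivative with hh
  have hpos : ∀ t, 0 < h.eval t ^ 2 + α ^ 2 := fun t => by positivity
  have hne : ∀ t, h.eval t ^ 2 + α ^ 2 ≠ 0 := fun t => (hpos t).ne'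
  -- With `1 = α²/(h² + α²) + k h` and `e' = i h e`, the second part of `e` is `-i k e'` and can be
  -- integrated by parts. Unlike `1/h`, the factor `k` has no singularity and satisfies `|k| ≤
  -- 1/(2α)`.
  set k : ℝ → ℝ := fun t => h.eval t / (h.eval t ^ 2 + α ^ 2) with hk
  set k' : ℝ → ℝ := fun t =>
    h.derivative.eval t * (α ^ 2 - h.eval t ^ 2) / (h.eval t ^ 2 + α ^ 2) ^ 2 with hk'
  have hkd : ∀ t, HasDerivAt k (k' t) t := fun t => by
    have := (h.hasDerivAt t).div (((h.hasDerivAt t).pow 2).add_const (α ^ 2)) (hne t)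
    refine this.congr_deriv ?_
    simp only [hk']
    congr 1
    simp only [Nat.cast_ofNat, Nat.add_one_sub_one, pow_one, Pi.pow_apply]
    ring
  have hk'c : Continuous k' := by
    refine Continuous.div (by fun_prop) (by fun_prop) fun t => pow_ne_zero _ (hne t)
  have hkc : Continuous k := Continuous.div (by fun_prop) (by fun_prop) hne
  set e : ℝ → ℂ := fun t => Complex.exp (Q.eval t * Complex.I) with he
  have hed : ∀ t, HasDerivAt e (e t * (h.eval t * Complex.I)) t := fun t => by
    exact (((Q.hasDerivAt t).ofReal_comp).mul_const Complex.I).cexp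
  have hec : Continuous e := by
    simp only [he]
    fun_prop
  have hen : ∀ t, ‖e t‖ = 1 := fun t => Complex.norm_exp_ofReal_mul_I _
  have hknorm : ∀ t, |k t| ≤ 1 / (2 * α) := fun t => by
    simp only [hk]
    rw [abs_div, abs_of_pos (hpos t), div_le_div_iff₀ (hpos t) (by positivity)]
    nlinarith [sq_nonneg (|h.eval t| - α), sq_abs (h.eval t)]
  -- integration by parts
  have hparts := intervalIntegral.integral_mul_deriv_eq_deriv_mul (a := a) (b := b)
    (u := fun t => (k t : ℂ)) (v := e) (u' := fun t => (k' t : ℂ))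
    (v' := fun t => e t * (h.eval t * Complex.I))
    (fun t _ => (hkd t).ofReal_comp) (fun t _ => hed t)
    ((Complex.continuous_ofReal.comp hk'c).intervalIntegrable a b)
    ((by fun_prop : Continuous fun t => e t * (h.eval t * Complex.I)).intervalIntegrable a b)
  have hsplit : ∀ t, e t = ((α ^ 2 / (h.eval t ^ 2 + α ^ 2) : ℝ) : ℂ) * e t -
      Complex.I * ((k t : ℂ) * (e t * (h.eval t * Complex.I))) := fun t => by
    have h1 : (α ^ 2 / (h.eval t ^ 2 + α ^ 2) : ℝ) + k t * h.eval t = 1 := by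
      simp only [hk]
      have := hne t
      field_simp
      ring
    have h2 : ((α ^ 2 / (h.eval t ^ 2 + α ^ 2) : ℝ) : ℂ) + (k t : ℂ) * h.eval t = 1 := by
      exact_mod_cast congrArg (fun x : ℝ => (x : ℂ)) h1
    linear_combination (-e t) * h2 + (k t : ℂ) * ((h.eval t : ℝ) : ℂ) * e t * Complex.I_mul_I
  have hvc : Continuous fun t => α ^ 2 / (h.eval t ^ 2 + α ^ 2) :=
    Continuous.div (by fun_prop) (by fun_prop) hne
  have hI : ∫ t in a..b, e t = (∫ t in a..b, ((α ^ 2 / (h.eval t ^ 2 + α ^ 2) : ℝ) : ℂ) * e t) -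
      Complex.I * (k b * e b - k a * e a - ∫ t in a..b, (k' t : ℂ) * e t) := by
    rw [← hparts, ← intervalIntegral.integral_const_mul, ← intervalIntegral.integral_sub]
    · exact intervalIntegral.integral_congr fun t _ => hsplit t
    · exact ((Complex.continuous_ofReal.comp hvc).mul hec).intervalIntegrable a b
    · refine Continuous.intervalIntegrable ?_ a b
      fun_prop
  have hb1 : ‖∫ t in a..b, ((α ^ 2 / (h.eval t ^ 2 + α ^ 2) : ℝ) : ℂ) * e t‖ ≤
      ∫ t in a..b, α ^ 2 / (h.eval t ^ 2 + α ^ 2) := by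
    refine (intervalIntegral.norm_integral_le_integral_norm hab).trans (le_of_eq ?_)
    refine intervalIntegral.integral_congr fun t _ => ?_
    simp only [norm_mul, hen, mul_one, Complex.norm_real, Real.norm_eq_abs]
    exact abs_of_nonneg (by positivity)
  -- Since `|α² - h²| ≤ h² + α²`, the derivative of `k` is dominated by `|h'|/(h² + α²)`, the
  -- integrand of the arctangent variation.
  have hb2 : ‖∫ t in a..b, (k' t : ℂ) * e t‖ ≤ Real.pi / α * (h.natDegree + 1) := by
    refine (intervalIntegral.norm_integral_le_integral_norm hab).trans ?_
    refine le_trans ?_ (intervalIntegral_abs_derivative_div_le h hα hab)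
    refine intervalIntegral.integral_mono_on hab ?_ ?_ fun t _ => ?_
    · exact Continuous.intervalIntegrable (by fun_prop) a b
    · exact Continuous.intervalIntegrable (Continuous.div (by fun_prop) (by fun_prop) hne) a b
    · simp only [norm_mul, hen, mul_one, Complex.norm_real, Real.norm_eq_abs, hk']
      rw [abs_div, abs_mul, abs_of_pos (pow_pos (hpos t) 2), div_le_div_iff₀ (pow_pos (hpos t) 2)
        (hpos t), mul_assoc, pow_two (h.eval t ^ 2 + α ^ 2)]
      have : |α ^ 2 - h.eval t ^ 2| ≤ h.eval t ^ 2 + α ^ 2 := by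
        rw [abs_le]
        constructor <;> nlinarith [sq_nonneg (h.eval t), sq_nonneg α]
      gcongr
  have hkn : ∀ t, ‖(k t : ℂ) * e t‖ ≤ 1 / (2 * α) := fun t => by
    rw [norm_mul, hen, mul_one, Complex.norm_real]
    exact hknorm t
  rw [hI]
  calc _ ≤ ‖∫ t in a..b, ((α ^ 2 / (h.eval t ^ 2 + α ^ 2) : ℝ) : ℂ) * e t‖ +
        (‖(k b : ℂ) * e b‖ + ‖(k a : ℂ) * e a‖ + ‖∫ t in a..b, (k' t : ℂ) * e t‖) := by
        refine (norm_sub_le _ _).trans ?_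
        rw [norm_mul, Complex.norm_I, one_mul]
        gcongr
        refine (norm_sub_le _ _).trans ?_
        gcongr
        exact norm_sub_le _ _
    _ ≤ (∫ t in a..b, α ^ 2 / (h.eval t ^ 2 + α ^ 2)) +
        (1 / (2 * α) + 1 / (2 * α) + Real.pi / α * (h.natDegree + 1)) := by
        gcongr
        · exact hkn b
        · exact hkn a
    _ = _ := by
        field_simp
        ring

/-! ### Sublevel sets and the Mahler measure -/

/-- The function `|u|^(-1/2)` on the punctured interval `[-1, 1]`, extended by zero. -/
noncomputable def invSqrtBump (u : ℝ) : ℝ := (Set.Ioc (0 : ℝ) 1).indicator (fun v => v ^ (-(1 / 2) : ℝ)) |u|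

theorem integral_invSqrtBump : ∫ u, invSqrtBump u = 4 := by
  unfold invSqrtBump
  rw [integral_comp_abs, setIntegral_indicator measurableSet_Ioc,
    Set.inter_eq_self_of_subset_right Set.Ioc_subset_Ioi_self,
    ← intervalIntegral.integral_of_le zero_le_one, integral_rpow (Or.inl (by norm_num))]
  norm_num

theorem integrable_invSqrtBump : Integrable invSqrtBump := by
  -- A non-integrable function has integral `0` by convention, which the value `4` excludes.
  by_contra h
  have := integral_undef h
  rw [integral_invSqrtBump] at this
  norm_num at this

theorem invSqrtBump_nonneg (u : ℝ) : 0 ≤ invSqrtBump u :=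
  Set.indicator_nonneg (fun _ hx => Real.rpow_nonneg hx.1.le _) _

/-- A root with `‖z‖ ≥ 2` is so far from `[-1, 1]` that the ratio is at most `2`; for the others the
numerator is bounded and the distance is at least the horizontal one. The majorant has an integral
bounded independently of the root. -/
theorem sqrt_max_div_le {t : ℝ} (ht : |t| ≤ 1) {z : ℂ} (htz : t ≠ z.re) :
    (max 1 ‖z‖ / ‖(t : ℂ) - z‖) ^ (1 / 2 : ℝ) ≤ 4 + 2 * invSqrtBump (t - z.re) := by
  have hψ := invSqrtBump_nonneg (t - z.re)
  have hre : |t - z.re| ≤ ‖(t : ℂ) - z‖ := by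
    simpa using Complex.abs_re_le_norm ((t : ℂ) - z)
  have hpos : 0 < |t - z.re| := abs_pos.2 (sub_ne_zero.2 htz)
  have hy0 : 0 ≤ max 1 ‖z‖ / ‖(t : ℂ) - z‖ := by positivity
  have hle4 : max 1 ‖z‖ / ‖(t : ℂ) - z‖ ≤ 2 →
      (max 1 ‖z‖ / ‖(t : ℂ) - z‖) ^ (1 / 2 : ℝ) ≤ 4 + 2 * invSqrtBump (t - z.re) := by
    intro h
    rw [← Real.sqrt_eq_rpow]
    have : Real.sqrt (max 1 ‖z‖ / ‖(t : ℂ) - z‖) ≤ 4 :=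
      Real.sqrt_le_iff.2 ⟨by norm_num, by linarith⟩
    linarith
  by_cases hz : 2 ≤ ‖z‖
  · apply hle4
    have : ‖z‖ - 1 ≤ ‖(t : ℂ) - z‖ := by
      have h1 := norm_sub_norm_le z (t : ℂ)
      rw [norm_sub_rev] at h1
      simp only [Complex.norm_real, Real.norm_eq_abs] at h1
      linarith
    rw [div_le_iff₀ (by linarith), max_eq_right (by linarith)]
    linarith
  · by_cases h1 : 1 ≤ |t - z.re|
    · apply hle4
      rw [div_le_iff₀ (by linarith)]
      have : max 1 ‖z‖ ≤ 2 := max_le (by norm_num) (by linarith)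
      linarith
    · have hψ1 : invSqrtBump (t - z.re) = |t - z.re| ^ (-(1 / 2) : ℝ) :=
        Set.indicator_of_mem (Set.mem_Ioc.2 ⟨hpos, by linarith⟩) _
      have hm : max 1 ‖z‖ ≤ 4 := max_le (by norm_num) (by linarith)
      calc (max 1 ‖z‖ / ‖(t : ℂ) - z‖) ^ (1 / 2 : ℝ) ≤ (4 / |t - z.re|) ^ (1 / 2 : ℝ) := by
            gcongr
        _ = 2 * invSqrtBump (t - z.re) := by
            rw [hψ1, Real.div_rpow (by norm_num) hpos.le, Real.rpow_neg hpos.le,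
              ← Real.sqrt_eq_rpow, show (4 : ℝ) = 2 ^ 2 by norm_num,
              Real.sqrt_sq (by norm_num), div_eq_mul_inv]
        _ ≤ _ := by linarith

theorem intervalIntegral_bump_le {a b : ℝ} (hab : a ≤ b) (ha : -1 ≤ a) (hb : b ≤ 1) (x : ℝ) :
    ∫ t in a..b, (4 + 2 * invSqrtBump (t - x)) ≤ 16 := by
  have hi : Integrable fun t => invSqrtBump (t - x) := integrable_invSqrtBump.comp_sub_right x
  rw [intervalIntegral.integral_add (by simp) (hi.const_mul 2).intervalIntegrable,
    intervalIntegral.integral_const, intervalIntegral.integral_const_mul]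
  have : ∫ t in a..b, invSqrtBump (t - x) ≤ 4 := by
    rw [intervalIntegral.integral_of_le hab, ← integral_invSqrtBump,
      ← integral_sub_right_eq_self invSqrtBump x]
    exact setIntegral_le_integral hi (Filter.Eventually.of_forall fun t => invSqrtBump_nonneg _)
  simp only [smul_eq_mul]
  linarith

/-- The left side is at most `min(1, (α/y)²)`, which lies below every intermediate power. The small
exponents are the ones needed. -/
theorem sq_div_le_rpow {α y e : ℝ} (hα : 0 < α) (hy : 0 < y) (he0 : 0 ≤ e) (he : e ≤ 2) :
    α ^ 2 / (y ^ 2 + α ^ 2) ≤ (α / y) ^ e := by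
  by_cases h : α ≤ y
  · have h1 : α / y ≤ 1 := (div_le_one hy).2 h
    calc α ^ 2 / (y ^ 2 + α ^ 2) ≤ α ^ 2 / y ^ 2 := by
          gcongr
          linarith [sq_nonneg α]
      _ = (α / y) ^ (2 : ℝ) := by
          rw [← div_pow]
          norm_cast
      _ ≤ _ := Real.rpow_le_rpow_of_exponent_ge (by positivity) h1 he
  · have h1 : 1 ≤ α / y := (one_le_div hy).2 (by linarith)
    calc α ^ 2 / (y ^ 2 + α ^ 2) ≤ 1 := by
          rw [div_le_one (by positivity)]
          linarith [sq_nonneg y]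
      _ ≤ _ := Real.one_le_rpow h1 he0

open Polynomial in
/-- Smoothed sublevel sets of a polynomial on `[-1, 1]` in terms of its Mahler measure. -/
theorem integral_sq_div_le_mahlerMeasure (h : ℝ[X]) {N : ℕ} (hN : 1 ≤ N) (hdeg : h.natDegree ≤ N)
    {α : ℝ} (hα : 0 < α) (hαM : α ≤ (h.map (algebraMap ℝ ℂ)).mahlerMeasure)
    {a b : ℝ} (hab : a ≤ b) (ha : -1 ≤ a) (hb : b ≤ 1) :
    ∫ t in a..b, α ^ 2 / (h.eval t ^ 2 + α ^ 2) ≤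
      16 * (α / (h.map (algebraMap ℝ ℂ)).mahlerMeasure) ^ (1 / (2 * N : ℝ)) := by
  set p := h.map (algebraMap ℝ ℂ) with hp
  set M := p.mahlerMeasure with hM
  have hM0 : 0 < M := hα.trans_le hαM
  have hN' : (1 : ℝ) ≤ N := by exact_mod_cast hN
  have hpdeg : p.natDegree = h.natDegree := natDegree_map _
  have hratio : α / M ≤ 1 := (div_le_one hM0).2 hαM
  have hpeval : ∀ t : ℝ, ‖p.eval (t : ℂ)‖ = |h.eval t| := fun t => by
    have : p.eval (t : ℂ) = ((h.eval t : ℝ) : ℂ) := by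
      rw [hp, eval_map_algebraMap]
      exact (Polynomial.aeval_algebraMap_apply_eq_algebraMap_eval t h)
    rw [this, Complex.norm_real, Real.norm_eq_abs]
  have hci : IntervalIntegrable (fun t => α ^ 2 / (h.eval t ^ 2 + α ^ 2)) volume a b :=
    (Continuous.div (by fun_prop) (by fun_prop) fun t => by positivity).intervalIntegrable a b
  have hlen : b - a ≤ 2 := by linarith
  obtain ⟨n, z, hz⟩ : ∃ n : ℕ, ∃ z : Fin n → ℂ, p.roots = Finset.univ.val.map z := by
    refine ⟨p.roots.toList.length, p.roots.toList.get, ?_⟩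
    rw [Fin.univ_val_map, List.ofFn_get, Multiset.coe_toList]
  have hn : n = h.natDegree := by
    rw [← hpdeg, ← IsAlgClosed.card_roots_eq_natDegree, hz]
    simp
  -- Comparing this factorisation with that of `|h(t)|` writes `M/|h(t)|` as a product of one factor
  -- per root, with the leading coefficient cancelled.
  have hMprod : M = ‖p.leadingCoeff‖ * ∏ i, max 1 ‖z i‖ := by
    rw [hM, mahlerMeasure_eq_leadingCoeff_mul_prod_roots, hz, Multiset.map_map]
    rfl
  have hheval : ∀ t : ℝ, |h.eval t| = ‖p.leadingCoeff‖ * ∏ i, ‖(t : ℂ) - z i‖ := fun t => by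
    rw [← hpeval, (IsAlgClosed.splits p).eval_eq_prod_roots, hz, Multiset.map_map, norm_mul]
    congr 1
    exact norm_prod _ _
  have hlead : 0 < ‖p.leadingCoeff‖ := by
    by_contra hcon
    have : ‖p.leadingCoeff‖ = 0 := le_antisymm (not_lt.1 hcon) (norm_nonneg _)
    rw [hMprod, this, zero_mul] at hM0
    exact lt_irrefl _ hM0
  rcases Nat.eq_zero_or_pos n with hn0 | hn0
  · subst hn0
    have heq : ∀ t, |h.eval t| = M := fun t => by rw [hheval, hMprod]; simp
    have hle : ∀ t, α ^ 2 / (h.eval t ^ 2 + α ^ 2) ≤ (α / M) ^ (1 / (2 * N : ℝ)) := fun t => by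
      rw [← sq_abs (h.eval t), heq]
      refine sq_div_le_rpow hα hM0 (by positivity) ?_
      rw [div_le_iff₀ (by positivity)]
      linarith
    calc ∫ t in a..b, α ^ 2 / (h.eval t ^ 2 + α ^ 2)
        ≤ ∫ t in a..b, (α / M) ^ (1 / (2 * N : ℝ)) :=
          intervalIntegral.integral_mono_on hab hci (by simp) fun t _ => hle t
      _ = (b - a) * (α / M) ^ (1 / (2 * N : ℝ)) := by simp
      _ ≤ _ := by
          gcongr
          linarith
  · have hn1 : (1 : ℝ) ≤ n := by exact_mod_cast hn0
    have hnN : (n : ℝ) ≤ N := by exact_mod_cast hn.trans_le hdeg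
    have hpt : ∀ᵐ t : ℝ ∂volume.restrict (Set.uIoc a b), α ^ 2 / (h.eval t ^ 2 + α ^ 2) ≤
        (α / M) ^ (1 / (2 * N : ℝ)) *
          ∑ i, (1 / n : ℝ) * (4 + 2 * invSqrtBump (t - (z i).re)) := by
      -- The bump vanishes at `0`, so the pointwise majorant may fail when `t` is the real part of a
      -- root; these `t` form a finite set.
      have hfin : ∀ᵐ t : ℝ, t ∉ Set.range fun i => (z i).re := by
        refine measure_eq_zero_iff_ae_notMem.1 ?_
        exact (Set.finite_range _).measure_zero _
      rw [Set.uIoc_of_le hab]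
      filter_upwards [ae_restrict_of_ae hfin, ae_restrict_mem measurableSet_Ioc] with t ht htm
      have ht1 : |t| ≤ 1 := abs_le.2 ⟨by linarith [htm.1], by linarith [htm.2]⟩
      have htz : ∀ i, t ≠ (z i).re := fun i hi => ht ⟨i, hi.symm⟩
      have hdist : ∀ i, 0 < ‖(t : ℂ) - z i‖ := fun i => by
        rw [norm_pos_iff, sub_ne_zero]
        intro hcon
        exact htz i (by rw [← hcon, Complex.ofReal_re])
      have hh0 : 0 < |h.eval t| := by
        rw [hheval]
        exact mul_pos hlead (Finset.prod_pos fun i _ => hdist i)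
      have hfac : α / |h.eval t| = α / M * ∏ i, (max 1 ‖z i‖ / ‖(t : ℂ) - z i‖) := by
        rw [hheval, hMprod, Finset.prod_div_distrib]
        have h1 : ∏ i, ‖(t : ℂ) - z i‖ ≠ 0 := (Finset.prod_pos fun i _ => hdist i).ne'
        have h2 : ∏ i, max 1 ‖z i‖ ≠ 0 :=
          (Finset.prod_pos fun i _ => lt_max_of_lt_left one_pos).ne'
        field_simp
      have hy : ∀ i, 0 ≤ max 1 ‖z i‖ / ‖(t : ℂ) - z i‖ := fun i => by positivity
      -- The exponent `1/(2n)` is chosen so that the product over the `n` roots becomes a geometric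
      -- mean of square roots; AM-GM replaces it by an average, each term of which is integrable
      -- uniformly in the root.
      calc α ^ 2 / (h.eval t ^ 2 + α ^ 2) ≤ (α / |h.eval t|) ^ (1 / (2 * n : ℝ)) := by
            rw [← sq_abs (h.eval t)]
            refine sq_div_le_rpow hα hh0 (by positivity) ?_
            rw [div_le_iff₀ (by positivity)]
            linarith
        _ = (α / M) ^ (1 / (2 * n : ℝ)) *
            ∏ i, ((max 1 ‖z i‖ / ‖(t : ℂ) - z i‖) ^ (1 / 2 : ℝ)) ^ (1 / n : ℝ) := by
            rw [hfac, Real.mul_rpow (by positivity) (Finset.prod_nonneg fun i _ => hy i),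
              ← Real.finsetProd_rpow _ _ fun i _ => hy i]
            congr 1
            refine Finset.prod_congr rfl fun i _ => ?_
            rw [← Real.rpow_mul (hy i)]
            congr 1
            field_simp
        _ ≤ (α / M) ^ (1 / (2 * N : ℝ)) *
            ∑ i, (1 / n : ℝ) * (max 1 ‖z i‖ / ‖(t : ℂ) - z i‖) ^ (1 / 2 : ℝ) := by
            gcongr ?_ * ?_
            · refine Real.rpow_le_rpow_of_exponent_ge (by positivity) hratio ?_
              gcongr
            · refine Real.geom_mean_le_arith_mean_weighted _ _ _ (fun i _ => by positivity) ?_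
                fun i _ => Real.rpow_nonneg (hy i) _
              simp only [Finset.sum_const, Finset.card_univ, Fintype.card_fin, nsmul_eq_mul]
              field_simp
        _ ≤ _ := by
            gcongr with i
            exact sqrt_max_div_le ht1 (htz i)
    have hbi : ∀ i, IntervalIntegrable (fun t => (1 / n : ℝ) * (4 + 2 * invSqrtBump (t - (z i).re)))
        volume a b := fun i => by
      refine IntervalIntegrable.const_mul (IntervalIntegrable.add (by simp) ?_) _
      exact ((integrable_invSqrtBump.comp_sub_right _).const_mul 2).intervalIntegrable
    have hsi : IntervalIntegrable (fun t => ∑ i, (1 / n : ℝ) * (4 + 2 * invSqrtBump (t - (z i).re)))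
        volume a b := by
      have := IntervalIntegrable.sum Finset.univ fun i _ => hbi i
      simpa only [Finset.sum_fn] using! this
    calc ∫ t in a..b, α ^ 2 / (h.eval t ^ 2 + α ^ 2)
        ≤ ∫ t in a..b, (α / M) ^ (1 / (2 * N : ℝ)) *
          ∑ i, (1 / n : ℝ) * (4 + 2 * invSqrtBump (t - (z i).re)) := by
          refine intervalIntegral.integral_mono_ae_restrict hab hci (hsi.const_mul _) ?_
          rw [Set.uIoc_of_le hab] at hpt
          rwa [Filter.EventuallyLE, ← Measure.restrict_congr_set Ioc_ae_eq_Icc]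
      _ = (α / M) ^ (1 / (2 * N : ℝ)) *
          ∑ i, (1 / n : ℝ) * ∫ t in a..b, (4 + 2 * invSqrtBump (t - (z i).re)) := by
          rw [intervalIntegral.integral_const_mul,
            intervalIntegral.integral_finsetSum fun i _ => hbi i]
          simp_rw [intervalIntegral.integral_const_mul]
      _ ≤ (α / M) ^ (1 / (2 * N : ℝ)) * ∑ i : Fin n, (1 / n : ℝ) * 16 := by
          gcongr with i
          exact intervalIntegral_bump_le hab ha hb _
      _ = _ := by
          simp only [Finset.sum_const, Finset.card_univ, Fintype.card_fin, nsmul_eq_mul]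
          field_simp

open Polynomial in
-- The coefficient bound gives `Q'` a Mahler measure of at least `2^{-N} B^j`. Because `j > N/2`,
-- taking the `1/(2N)`-th root in the sublevel estimate loses only a constant and still gains a
-- power of `B` independent of `N`.
theorem norm_integral_exp_eval_le_of_coeff (Q : ℝ[X]) {N j : ℕ} (hdeg : Q.natDegree ≤ N)
    (hj : 1 ≤ j) (hjN : N < 2 * j) (hN : 1 ≤ N) {B : ℝ} (hB : 1 ≤ B) (hcoeff : B ^ j ≤ |Q.coeff j|)
    {a b : ℝ} (hab : a ≤ b) (ha : -1 ≤ a) (hb : b ≤ 1) :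
    ‖∫ t in a..b, Complex.exp (Q.eval t * Complex.I)‖ ≤ 40 * N * B ^ (-(1 / 8) : ℝ) := by
  have hB0 : 0 < B := by linarith
  have hN' : (1 : ℝ) ≤ N := by exact_mod_cast hN
  -- This makes the `N/α` term of size `N B^{-1/8}`; the sublevel term becomes `B^{1/(16N) - 1/4}`
  -- up to a constant, which is smaller.
  set α : ℝ := B ^ (1 / 8 : ℝ) with hα
  have hα0 : 0 < α := Real.rpow_pos_of_pos hB0 _
  set h := Q.derivative with hh
  have hhdeg : h.natDegree ≤ N - 1 := (natDegree_derivative_le Q).trans (Nat.sub_le_sub_right hdeg 1)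
  have hhdegN : h.natDegree ≤ N := hhdeg.trans (Nat.sub_le _ _)
  set M := (h.map (algebraMap ℝ ℂ)).mahlerMeasure with hM
  -- the Mahler measure is large
  have hMB : B ^ j ≤ 2 ^ N * M := by
    have h1 := norm_coeff_le_choose_mul_mahlerMeasure (j - 1) (h.map (algebraMap ℝ ℂ))
    rw [natDegree_map, coeff_map, Complex.coe_algebraMap, Complex.norm_real, Real.norm_eq_abs,
      hh, coeff_derivative, Nat.sub_add_cancel hj, abs_mul] at h1
    have h2 : (1 : ℝ) ≤ |((j - 1 : ℕ) : ℝ) + 1| := by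
      rw [abs_of_nonneg (by positivity)]
      linarith [Nat.cast_nonneg (α := ℝ) (j - 1)]
    have h3 : ((h.natDegree.choose (j - 1) : ℕ) : ℝ) ≤ 2 ^ N := by
      exact_mod_cast (Nat.choose_le_two_pow _ _).trans (Nat.pow_le_pow_right (by norm_num) hhdegN)
    calc B ^ j ≤ |Q.coeff j| := hcoeff
      _ ≤ |Q.coeff j| * |((j - 1 : ℕ) : ℝ) + 1| := le_mul_of_one_le_right (abs_nonneg _) h2
      _ ≤ _ := h1
      _ ≤ 2 ^ N * M := by
        gcongr
        exact mahlerMeasure_nonneg _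
  have hM0 : 0 < M := by
    have : 0 < 2 ^ N * M := (pow_pos hB0 j).trans_le hMB
    exact (mul_pos_iff_of_pos_left (by positivity)).1 this
  have hci : IntervalIntegrable (fun t => α ^ 2 / (h.eval t ^ 2 + α ^ 2)) volume a b :=
    (Continuous.div (by fun_prop) (by fun_prop) fun t => by positivity).intervalIntegrable a b
  have hV : ∫ t in a..b, α ^ 2 / (h.eval t ^ 2 + α ^ 2) ≤ 16 * (α / M) ^ (1 / (2 * N : ℝ)) := by
    by_cases hαM : α ≤ M
    · exact integral_sq_div_le_mahlerMeasure h hN hhdegN hα0 hαM hab ha hb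
    -- Here the claimed bound exceeds `16`, while the interval has length at most `2`.
    · have h1 : 1 ≤ (α / M) ^ (1 / (2 * N : ℝ)) :=
        Real.one_le_rpow ((one_le_div hM0).2 (by linarith)) (by positivity)
      calc ∫ t in a..b, α ^ 2 / (h.eval t ^ 2 + α ^ 2) ≤ ∫ t in a..b, (1 : ℝ) := by
            refine intervalIntegral.integral_mono_on hab hci (by simp) fun t _ => ?_
            rw [div_le_one (by positivity)]
            linarith [sq_nonneg (h.eval t)]
        _ = b - a := by simp
        _ ≤ _ := by linarith
  have hpow : (α / M) ^ (1 / (2 * N : ℝ)) ≤ 2 * B ^ (-(1 / 8) : ℝ) := by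
    have h1 : α / M ≤ 2 ^ N * B ^ (1 / 8 - N / 2 : ℝ) := by
      rw [div_le_iff₀ hM0]
      have h2 : B ^ (N / 2 : ℝ) ≤ 2 ^ N * M := by
        refine le_trans ?_ hMB
        rw [← Real.rpow_natCast]
        refine Real.rpow_le_rpow_of_exponent_le hB ?_
        have : (N : ℝ) < 2 * j := by exact_mod_cast hjN
        linarith
      calc α = B ^ (1 / 8 - N / 2 : ℝ) * B ^ (N / 2 : ℝ) := by
            rw [hα, ← Real.rpow_add hB0]
            ring_nf
        _ ≤ B ^ (1 / 8 - N / 2 : ℝ) * (2 ^ N * M) := by gcongr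
        _ = _ := by ring
    calc (α / M) ^ (1 / (2 * N : ℝ))
        ≤ (2 ^ N * B ^ (1 / 8 - N / 2 : ℝ)) ^ (1 / (2 * N : ℝ)) := by gcongr
      _ = 2 ^ (1 / 2 : ℝ) * B ^ ((1 / 8 - N / 2) * (1 / (2 * N)) : ℝ) := by
          rw [Real.mul_rpow (by positivity) (by positivity), ← Real.rpow_natCast,
            ← Real.rpow_mul (by norm_num), ← Real.rpow_mul hB0.le]
          congr 2
          field_simp
      _ ≤ 2 ^ (1 : ℝ) * B ^ (-(1 / 8) : ℝ) := by
          gcongr ?_ * ?_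
          · exact Real.rpow_le_rpow_of_exponent_le (by norm_num) (by norm_num)
          · refine Real.rpow_le_rpow_of_exponent_le hB ?_
            have : (1 / 8 - N / 2) * (1 / (2 * N)) = 1 / (16 * N) - (1 / 4 : ℝ) := by
              field_simp
              ring
            rw [this]
            have : 1 / (16 * N : ℝ) ≤ 1 / 16 := by
              gcongr
              linarith
            linarith
      _ = _ := by rw [Real.rpow_one]
  have hαinv : 1 / α = B ^ (-(1 / 8) : ℝ) := by rw [hα, Real.rpow_neg hB0.le, one_div]
  have hdeg1 : (h.natDegree : ℝ) + 1 ≤ N := by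
    have : h.natDegree + 1 ≤ N := by omega
    exact_mod_cast this
  calc _ ≤ _ := norm_integral_exp_eval_le Q hα0 hab
    _ ≤ 16 * (2 * B ^ (-(1 / 8) : ℝ)) + (1 + 4 * N) * B ^ (-(1 / 8) : ℝ) := by
        rw [div_eq_mul_one_div _ α, hαinv]
        gcongr
        · exact hV.trans (by gcongr)
        · exact Real.pi_le_four
    _ = (33 + 4 * N) * B ^ (-(1 / 8) : ℝ) := by ring
    _ ≤ _ := by
        gcongr
        linarith

/-! ### Dyadic blocks of the parabolic norm -/

/-- The contribution of the `l`-th dyadic block of coordinates to the parabolic norm. -/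
noncomputable def blockNorm {d : ℕ} (l : ℕ) (x : E d) : ℝ :=
  (∑ i ∈ Finset.univ.filter (fun i : Fin d => 2 ^ l < 2 * ((i : ℕ) + 1) ∧ (i : ℕ) + 1 ≤ 2 ^ l),
      |x i| ^ ((2 : ℝ) ^ l / ((i : ℕ) + 1 : ℝ))) ^ (1 / (2 : ℝ) ^ l)

theorem parabolicNorm_eq_sum_blockNorm {d : ℕ} (x : E d) :
    parabolicNorm x = ∑ l ∈ Finset.range (Nat.clog 2 d + 1), blockNorm l x := rfl

theorem blockNorm_nonneg {d : ℕ} (l : ℕ) (x : E d) : 0 ≤ blockNorm l x :=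
  Real.rpow_nonneg (Finset.sum_nonneg fun _ _ => Real.rpow_nonneg (abs_nonneg _) _) _

theorem parabolicNorm_nonneg {d : ℕ} (x : E d) : 0 ≤ parabolicNorm x :=
  Finset.sum_nonneg fun l _ => blockNorm_nonneg l x

/-- Each index lies in exactly one block, so sums over coordinates can be fibred over `Nat.clog 2
j`. -/
theorem mem_block_iff {j l : ℕ} (hj : 1 ≤ j) :
    (2 ^ l < 2 * j ∧ j ≤ 2 ^ l) ↔ Nat.clog 2 j = l := by
  rw [← Nat.clog_le_iff_le_pow (by norm_num)]
  cases l with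
  | zero => simp; omega
  | succ l =>
    rw [pow_succ, mul_comm, Nat.mul_lt_mul_left (by norm_num), ← Nat.lt_clog_iff_pow_lt (by norm_num)]
    omega

/-- Every term `|x_j|^{2^l/j}` scales by `s^{2^l}`, whatever `j` is. This turns the sum over dyadic
dilations into scalar sums, one for each block. -/
theorem blockNorm_dilation {d : ℕ} (l : ℕ) {s : ℝ} (hs : 0 < s) (x : E d) :
    blockNorm l (dilation s x) = s * blockNorm l x := by
  have hs2 : (s ^ ((2 : ℝ) ^ l)) ^ (1 / (2 : ℝ) ^ l) = s := by
    rw [← Real.rpow_mul hs.le, mul_one_div, div_self (by positivity), Real.rpow_one]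
  unfold blockNorm
  nth_rewrite 2 [← hs2]
  rw [← Real.mul_rpow (by positivity) (by positivity), Finset.mul_sum]
  congr 1
  refine Finset.sum_congr rfl fun i _ => ?_
  simp only [dilation]
  rw [abs_mul, abs_of_pos (by positivity), Real.mul_rpow (by positivity) (abs_nonneg _),
    ← Real.rpow_natCast, ← Real.rpow_mul hs.le]
  congr 2
  push_cast
  field_simp

theorem abs_le_blockNorm_pow {d : ℕ} {l : ℕ} (x : E d) (i : Fin d)
    (hi : 2 ^ l < 2 * ((i : ℕ) + 1) ∧ (i : ℕ) + 1 ≤ 2 ^ l) :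
    |x i| ≤ blockNorm l x ^ ((i : ℕ) + 1) := by
  have h1 : |x i| ^ ((2 : ℝ) ^ l / ((i : ℕ) + 1 : ℝ)) ≤
      ∑ i ∈ Finset.univ.filter (fun i : Fin d => 2 ^ l < 2 * ((i : ℕ) + 1) ∧ (i : ℕ) + 1 ≤ 2 ^ l),
      |x i| ^ ((2 : ℝ) ^ l / ((i : ℕ) + 1 : ℝ)) :=
    Finset.single_le_sum (f := fun i : Fin d => |x i| ^ ((2 : ℝ) ^ l / ((i : ℕ) + 1 : ℝ)))
      (fun _ _ => Real.rpow_nonneg (abs_nonneg _) _) (by simpa using hi)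
  calc |x i| = ((|x i| ^ ((2 : ℝ) ^ l / ((i : ℕ) + 1 : ℝ))) ^ (1 / (2 : ℝ) ^ l)) ^ ((i : ℕ) + 1) := by
        rw [← Real.rpow_natCast, ← Real.rpow_mul (abs_nonneg _), ← Real.rpow_mul (abs_nonneg _)]
        have : (2 : ℝ) ^ l / ((i : ℕ) + 1 : ℝ) * (1 / (2 : ℝ) ^ l) * ((i : ℕ) + 1 : ℕ) = 1 := by
          push_cast
          field_simp
        rw [this, Real.rpow_one]
    _ ≤ _ := by
        unfold blockNorm
        gcongr

/-- Otherwise each term of the block sum is below `(r/2)^{2^l}`; there are at most `2^l ≤ 2^{2^l}`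
terms, so the sum would be below `r^{2^l}`. -/
theorem exists_blockNorm_half_pow_le {d : ℕ} {l : ℕ} (x : E d) (h : 0 < blockNorm l x) :
    ∃ i : Fin d, (2 ^ l < 2 * ((i : ℕ) + 1) ∧ (i : ℕ) + 1 ≤ 2 ^ l) ∧
      (blockNorm l x / 2) ^ ((i : ℕ) + 1) ≤ |x i| := by
  by_contra! hcon
  set s := Finset.univ.filter (fun i : Fin d => 2 ^ l < 2 * ((i : ℕ) + 1) ∧ (i : ℕ) + 1 ≤ 2 ^ l)
    with hs
  set r := blockNorm l x with hr
  have hsne : s.Nonempty := by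
    by_contra hne
    rw [Finset.not_nonempty_iff_eq_empty] at hne
    have : r = 0 := by
      rw [hr, blockNorm, ← hs, hne, Finset.sum_empty]
      exact Real.zero_rpow (by positivity)
    linarith
  have hcard : (s.card : ℝ) ≤ 2 ^ (2 : ℝ) ^ l := by
    have h1 : s.card ≤ 2 ^ l := by
      have : s.card ≤ (Finset.range (2 ^ l)).card := by
        refine Finset.card_le_card_of_injOn (fun i => (i : ℕ)) (fun i hi => ?_)
          (fun i _ j _ hij => Fin.ext hij)
        simp only [hs, Finset.coe_filter, Set.mem_ofPred_eq] at hi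
        simp only [Finset.coe_range, Set.mem_Iio]
        omega
      simpa using this
    have h2 : s.card ≤ 2 ^ 2 ^ l := h1.trans Nat.lt_two_pow_self.le
    have h3 : ((s.card : ℕ) : ℝ) ≤ ((2 ^ 2 ^ l : ℕ) : ℝ) := by exact_mod_cast h2
    refine h3.trans (le_of_eq ?_)
    push_cast
    rw [← Real.rpow_natCast]
    push_cast
    rfl
  have hlt : ∑ i ∈ s, |x i| ^ ((2 : ℝ) ^ l / ((i : ℕ) + 1 : ℝ)) <
      ∑ i ∈ s, (r / 2) ^ ((2 : ℝ) ^ l) := by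
    refine Finset.sum_lt_sum_of_nonempty hsne fun i hi => ?_
    have hi' := hcon i (by simpa [hs] using hi)
    calc |x i| ^ ((2 : ℝ) ^ l / ((i : ℕ) + 1 : ℝ))
        < ((r / 2) ^ ((i : ℕ) + 1)) ^ ((2 : ℝ) ^ l / ((i : ℕ) + 1 : ℝ)) := by
          exact Real.rpow_lt_rpow (abs_nonneg _) hi' (by positivity)
      _ = _ := by
          rw [← Real.rpow_natCast, ← Real.rpow_mul (by positivity)]
          congr 1
          push_cast
          field_simp
  have hle : ∑ i ∈ s, (r / 2) ^ ((2 : ℝ) ^ l) ≤ r ^ ((2 : ℝ) ^ l) := by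
    rw [Finset.sum_const, nsmul_eq_mul, Real.div_rpow h.le (by norm_num)]
    calc (s.card : ℝ) * (r ^ (2 : ℝ) ^ l / 2 ^ (2 : ℝ) ^ l)
        ≤ 2 ^ (2 : ℝ) ^ l * (r ^ (2 : ℝ) ^ l / 2 ^ (2 : ℝ) ^ l) := by gcongr
      _ = _ := by field_simp
  have hfin : r < r := by
    calc r = (∑ i ∈ s, |x i| ^ ((2 : ℝ) ^ l / ((i : ℕ) + 1 : ℝ))) ^ (1 / (2 : ℝ) ^ l) := rfl
      _ < (r ^ ((2 : ℝ) ^ l)) ^ (1 / (2 : ℝ) ^ l) :=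
        Real.rpow_lt_rpow (Finset.sum_nonneg fun _ _ => Real.rpow_nonneg (abs_nonneg _) _)
          (hlt.trans_le hle) (by positivity)
      _ = r := by rw [← Real.rpow_mul h.le, mul_one_div, div_self (by positivity), Real.rpow_one]
  exact lt_irrefl _ hfin

/-- For `r ≤ 1/2` the bound `|x_j| ≤ r^j` gives a geometric series, so the constant does not depend
on the size of the block. -/
theorem sum_abs_block_le {d : ℕ} {l : ℕ} (x : E d) (h : blockNorm l x ≤ 1 / 2) :
    ∑ i ∈ Finset.univ.filter (fun i : Fin d => Nat.clog 2 ((i : ℕ) + 1) = l), |x i| ≤ 2 * blockNorm l x := by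
  have h0 := blockNorm_nonneg l x
  calc ∑ i ∈ Finset.univ.filter (fun i : Fin d => Nat.clog 2 ((i : ℕ) + 1) = l), |x i|
      ≤ ∑ i ∈ Finset.univ.filter (fun i : Fin d => Nat.clog 2 ((i : ℕ) + 1) = l), blockNorm l x * (1 / 2) ^ (i : ℕ) := by
        refine Finset.sum_le_sum fun i hi => ?_
        have hi' := (mem_block_iff (Nat.succ_le_succ (Nat.zero_le (i : ℕ)))).2
          (Finset.mem_filter.1 hi).2
        calc |x i| ≤ blockNorm l x ^ ((i : ℕ) + 1) := abs_le_blockNorm_pow x i hi'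
          _ = blockNorm l x * blockNorm l x ^ (i : ℕ) := by ring
          _ ≤ _ := by gcongr
    _ ≤ ∑ i : Fin d, blockNorm l x * (1 / 2) ^ (i : ℕ) :=
        Finset.sum_le_sum_of_subset_of_nonneg (Finset.filter_subset _ _) fun i _ _ => by positivity
    _ = blockNorm l x * ∑ i ∈ Finset.range d, (1 / 2 : ℝ) ^ i := by
        rw [← Finset.mul_sum, Finset.sum_range]
    _ ≤ blockNorm l x * 2 := by
        gcongr
        exact (Summable.sum_le_tsum _ (fun _ _ => by positivity) summable_geometric_two).trans
          tsum_geometric_two.le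
    _ = _ := by ring

/-! ### The Fourier transform of the curve measure -/

/-- The Fourier transform of `σ`. -/
noncomputable def curveIntegral {d : ℕ} (x : E d) : ℂ :=
  ∫ t in {t : ℝ | 1 / 2 < |t| ∧ |t| ≤ 1},
    Complex.exp (((∑ i, -(2 * Real.pi * x i) * t ^ ((i : ℕ) + 1) : ℝ) : ℂ) * Complex.I)

theorem annulus_eq : {t : ℝ | 1 / 2 < |t| ∧ |t| ≤ 1} =
    Set.Ico (-1) (-(1 / 2)) ∪ Set.Ioc (1 / 2) 1 := by
  ext t
  simp only [Set.mem_ofPred_eq, Set.mem_union, Set.mem_Ico, Set.mem_Ioc]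
  rcases abs_cases t with ⟨h, h'⟩ | ⟨h, h'⟩ <;> rw [h]
  · exact ⟨Or.inr, fun h => h.elim (fun h => by constructor <;> linarith [h.1, h.2]) id⟩
  · exact ⟨fun h => Or.inl ⟨by linarith [h.2], by linarith [h.1]⟩,
      fun h => by rcases h with h | h <;> constructor <;> linarith [h.1, h.2]⟩

theorem disjoint_annulus : Disjoint (Set.Ico (-1 : ℝ) (-(1 / 2))) (Set.Ioc (1 / 2) 1) := by
  rw [Set.disjoint_left]
  intro t h1 h2
  linarith [h1.2, h2.1]

theorem volume_annulus : volume {t : ℝ | 1 / 2 < |t| ∧ |t| ≤ 1} = 1 := by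
  rw [annulus_eq, measure_union disjoint_annulus measurableSet_Ioc, Real.volume_Ico,
    Real.volume_Ioc, ← ENNReal.ofReal_add (by norm_num) (by norm_num)]
  norm_num

theorem integrableOn_annulus {f : ℝ → ℂ} (hf : Continuous f) :
    IntegrableOn f {t : ℝ | 1 / 2 < |t| ∧ |t| ≤ 1} := by
  rw [annulus_eq]
  exact (((hf.integrableOn_Icc).mono_set Set.Ico_subset_Icc_self).union
    ((hf.integrableOn_Icc).mono_set Set.Ioc_subset_Icc_self))

theorem setIntegral_annulus {f : ℝ → ℂ} (hf : Continuous f) :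
    ∫ t in {t : ℝ | 1 / 2 < |t| ∧ |t| ≤ 1}, f t =
      (∫ t in (-1 : ℝ)..(-(1 / 2)), f t) + ∫ t in (1 / 2 : ℝ)..1, f t := by
  rw [annulus_eq, setIntegral_union disjoint_annulus measurableSet_Ioc
    ((hf.integrableOn_Icc).mono_set Set.Ico_subset_Icc_self)
    ((hf.integrableOn_Icc).mono_set Set.Ioc_subset_Icc_self),
    intervalIntegral.integral_of_le (by norm_num), intervalIntegral.integral_of_le (by norm_num),
    integral_Ico_eq_integral_Ioc]

theorem continuous_curvePhase {d : ℕ} (x : E d) : Continuous fun t : ℝ =>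
    Complex.exp (((∑ i, -(2 * Real.pi * x i) * t ^ ((i : ℕ) + 1) : ℝ) : ℂ) * Complex.I) := by
  fun_prop

theorem norm_curveIntegral_le_one {d : ℕ} (x : E d) : ‖curveIntegral x‖ ≤ 1 := by
  have := norm_setIntegral_le_of_norm_le_const (μ := volume)
    (s := {t : ℝ | 1 / 2 < |t| ∧ |t| ≤ 1}) (C := 1) (by rw [volume_annulus]; simp)
    (f := fun t : ℝ =>
      Complex.exp (((∑ i, -(2 * Real.pi * x i) * t ^ ((i : ℕ) + 1) : ℝ) : ℂ) * Complex.I))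
    (fun t _ => (Complex.norm_exp_ofReal_mul_I _).le)
  rw [measureReal_def, volume_annulus, ENNReal.toReal_one, mul_one] at this
  exact this

theorem norm_exp_ofReal_mul_I_sub_le (a b : ℝ) :
    ‖Complex.exp (a * Complex.I) - Complex.exp (b * Complex.I)‖ ≤ |a - b| := by
  have h : Complex.exp (a * Complex.I) - Complex.exp (b * Complex.I) =
      Complex.exp (b * Complex.I) * (Complex.exp (Complex.I * (a - b : ℝ)) - 1) := by
    rw [mul_sub, ← Complex.exp_add, mul_one]
    congr 2
    push_cast
    ring
  rw [h, norm_mul, Complex.norm_exp_ofReal_mul_I, one_mul]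
  exact (Real.norm_exp_I_mul_ofReal_sub_one_le).trans (le_of_eq (Real.norm_eq_abs _))

/-- All powers of `t` are at most `1` in modulus on the annulus. The bound serves both near the
origin and for deleting small coordinates. -/
theorem norm_curveIntegral_sub_le {d : ℕ} (x y : E d) :
    ‖curveIntegral x - curveIntegral y‖ ≤ 2 * Real.pi * ∑ i, |x i - y i| := by
  unfold curveIntegral
  rw [← integral_sub (integrableOn_annulus (continuous_curvePhase x))
    (integrableOn_annulus (continuous_curvePhase y))]
  have := norm_setIntegral_le_of_norm_le_const (μ := volume)
    (s := {t : ℝ | 1 / 2 < |t| ∧ |t| ≤ 1}) (C := 2 * Real.pi * ∑ i, |x i - y i|)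
    (by rw [volume_annulus]; simp)
    (f := fun t : ℝ =>
      Complex.exp (((∑ i, -(2 * Real.pi * x i) * t ^ ((i : ℕ) + 1) : ℝ) : ℂ) * Complex.I) -
      Complex.exp (((∑ i, -(2 * Real.pi * y i) * t ^ ((i : ℕ) + 1) : ℝ) : ℂ) * Complex.I))
    (fun t ht => by
      refine (norm_exp_ofReal_mul_I_sub_le _ _).trans ?_
      rw [← Finset.sum_sub_distrib, Finset.mul_sum]
      refine (Finset.abs_sum_le_sum_abs _ _).trans (Finset.sum_le_sum fun i _ => ?_)
      have h1 : |t| ^ ((i : ℕ) + 1) ≤ 1 := pow_le_one₀ (abs_nonneg _) ht.2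
      calc |-(2 * Real.pi * x i) * t ^ ((i : ℕ) + 1) - -(2 * Real.pi * y i) * t ^ ((i : ℕ) + 1)|
          = |(2 * Real.pi) * (x i - y i) * t ^ ((i : ℕ) + 1)| := by
            rw [← abs_neg]
            ring_nf
        _ = 2 * Real.pi * |x i - y i| * |t| ^ ((i : ℕ) + 1) := by
            rw [abs_mul, abs_mul, abs_pow, abs_of_pos Real.two_pi_pos]
        _ ≤ 2 * Real.pi * |x i - y i| :=
            mul_le_of_le_one_right (mul_nonneg Real.two_pi_pos.le (abs_nonneg _)) h1)
  rw [measureReal_def, volume_annulus, ENNReal.toReal_one, mul_one] at this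
  exact this

open Polynomial in
theorem norm_curveIntegral_le_of_coeff {d N : ℕ} (hN : 1 ≤ N) (y : E d)
    (hy : ∀ i : Fin d, N < (i : ℕ) + 1 → y i = 0) (i : Fin d) (hi : N < 2 * ((i : ℕ) + 1))
    {B : ℝ} (hB : 1 ≤ B) (hBi : B ^ ((i : ℕ) + 1) ≤ |y i|) :
    ‖curveIntegral y‖ ≤ 80 * N * B ^ (-(1 / 8) : ℝ) := by
  set Q : ℝ[X] := ∑ i : Fin d, C (-(2 * Real.pi * y i)) * X ^ ((i : ℕ) + 1) with hQ
  have heval : ∀ t : ℝ, Q.eval t = ∑ i, -(2 * Real.pi * y i) * t ^ ((i : ℕ) + 1) := fun t => by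
    simp [hQ, eval_finsetSum]
  have hdeg : Q.natDegree ≤ N := by
    refine natDegree_sum_le_of_forall_le _ _ fun j _ => ?_
    by_cases hj : N < (j : ℕ) + 1
    · simp [hy j hj]
    · exact (natDegree_C_mul_X_pow_le _ _).trans (not_lt.1 hj)
  have hcoeff : Q.coeff ((i : ℕ) + 1) = -(2 * Real.pi * y i) := by
    rw [hQ, finsetSum_coeff, Finset.sum_eq_single i]
    · rw [coeff_C_mul_X_pow, if_pos rfl]
    · intro j _ hj
      rw [coeff_C_mul_X_pow, if_neg]
      intro h
      exact hj (Fin.ext (by omega))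
    · simp
  have hc : B ^ ((i : ℕ) + 1) ≤ |Q.coeff ((i : ℕ) + 1)| := by
    rw [hcoeff, abs_neg, abs_mul, abs_of_pos Real.two_pi_pos]
    refine hBi.trans (le_mul_of_one_le_left (abs_nonneg _) ?_)
    linarith [Real.pi_gt_three]
  unfold curveIntegral
  rw [setIntegral_annulus (continuous_curvePhase y)]
  simp_rw [← heval]
  have e1 := norm_integral_exp_eval_le_of_coeff Q hdeg (Nat.succ_le_succ (Nat.zero_le (i : ℕ))) hi hN
    hB hc (a := -1) (b := -(1 / 2)) (by norm_num) le_rfl (by norm_num)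
  have e2 := norm_integral_exp_eval_le_of_coeff Q hdeg (Nat.succ_le_succ (Nat.zero_le (i : ℕ))) hi hN
    hB hc (a := 1 / 2) (b := 1) (by norm_num) (by norm_num) le_rfl
  refine (norm_add_le _ _).trans ?_
  linarith

/-! ### The pointwise multiplier bound and its dyadic sum -/

/-- The profile that dominates the contribution of a dyadic block of parabolic norm `r`:
linear for small `r`, constant up to `D`, and slowly decaying beyond. -/
noncomputable def decayProfile (D r : ℝ) : ℝ := min r (min 1 ((D / r) ^ (1 / 8 : ℝ)))

theorem decayProfile_nonneg {D r : ℝ} (hD : 0 ≤ D) (hr : 0 ≤ r) : 0 ≤ decayProfile D r :=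
  le_min hr (le_min zero_le_one (Real.rpow_nonneg (div_nonneg hD hr) _))

theorem decayProfile_of_le_one {D r : ℝ} (hD : 1 ≤ D) (hr : 0 ≤ r) (hr1 : r ≤ 1) :
    decayProfile D r = r := by
  unfold decayProfile
  rcases hr.eq_or_lt with rfl | hr0
  · exact min_eq_left (le_min zero_le_one (Real.rpow_nonneg (by simp) _))
  · refine min_eq_left (le_min hr1 (hr1.trans (Real.one_le_rpow ?_ (by norm_num))))
    rw [one_le_div hr0]
    linarith

theorem decayProfile_of_ge {D r : ℝ} (hD : 1 ≤ D) (hr : D ≤ r) :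
    decayProfile D r = (D / r) ^ (1 / 8 : ℝ) := by
  have h0 : 0 < r := by linarith
  have h1 : (D / r) ^ (1 / 8 : ℝ) ≤ 1 :=
    Real.rpow_le_one (by positivity) ((div_le_one h0).2 hr) (by norm_num)
  unfold decayProfile
  rw [min_eq_right h1, min_eq_right (by linarith)]

theorem half_le_decayProfile {D r : ℝ} (hr : 1 / 2 ≤ r) (hrD : r ≤ D) :
    1 / 2 ≤ decayProfile D r := by
  have h0 : 0 < r := by linarith
  refine le_min hr (le_min (by norm_num) ?_)
  exact le_trans (by norm_num) (Real.one_le_rpow ((one_le_div h0).2 hrD) (by norm_num : (0:ℝ) ≤ 1 / 8))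

theorem clog_succ_mem_range {d : ℕ} (i : Fin d) :
    Nat.clog 2 ((i : ℕ) + 1) ∈ Finset.range (Nat.clog 2 d + 1) :=
  Finset.mem_range.2 (Nat.lt_succ_of_le (Nat.clog_mono_right 2 i.2))

theorem two_pow_le_two_mul {d l : ℕ} (hd : 2 ≤ d) (hl : l ≤ Nat.clog 2 d) : 2 ^ l ≤ 2 * d := by
  have h1 : Nat.clog 2 d ≠ 0 := (Nat.clog_pos (by norm_num) hd).ne'
  obtain ⟨m, hm⟩ := Nat.exists_eq_succ_of_ne_zero h1
  have h2 : 2 ^ m < d := by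
    rw [← Nat.lt_clog_iff_pow_lt (by norm_num), hm]
    exact Nat.lt_succ_self m
  calc 2 ^ l ≤ 2 ^ (m + 1) := Nat.pow_le_pow_right (by norm_num) (hl.trans hm.le)
    _ = 2 * 2 ^ m := by ring
    _ ≤ 2 * d := by omega

/-- Three cases: some block norm in `[1/2, D]`, where the trivial bound `2` suffices; otherwise some
block norm above `D`, where oscillation gives decay; otherwise all small, where both transforms are
close to `1`. -/
theorem norm_curveIntegral_sub_exp_le {d : ℕ} (hd : 2 ≤ d) (x : E d) :
    ‖curveIntegral x - (Real.exp (-parabolicNorm x) : ℂ)‖ ≤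
      340 * ∑ l ∈ Finset.range (Nat.clog 2 d + 1), decayProfile ((d : ℝ) ^ 8) (blockNorm l x) := by
  set R := Finset.range (Nat.clog 2 d + 1) with hR
  -- The eighth power makes `D^{1/8} = d`, which absorbs the factor `N ≤ 2d` of the oscillatory
  -- estimate.
  obtain ⟨D, hDdef⟩ : ∃ D : ℝ, D = (d : ℝ) ^ 8 := ⟨_, rfl⟩
  rw [← hDdef]
  have hd2 : (2 : ℝ) ≤ d := by exact_mod_cast hd
  have hD1 : 1 ≤ D := hDdef ▸ one_le_pow₀ (by linarith)
  have hD8 : D ^ (1 / 8 : ℝ) = d := by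
    rw [hDdef, ← Real.rpow_natCast, ← Real.rpow_mul (by positivity)]
    norm_num
  have hr0 : ∀ l, 0 ≤ blockNorm l x := fun l => blockNorm_nonneg l x
  have hg0 : ∀ l, 0 ≤ decayProfile D (blockNorm l x) := fun l =>
    decayProfile_nonneg (by linarith) (hr0 l)
  have hρ0 := parabolicNorm_nonneg x
  have hexp : ‖(Real.exp (-parabolicNorm x) : ℂ)‖ = Real.exp (-parabolicNorm x) := by
    rw [Complex.norm_real, Real.norm_eq_abs, abs_of_pos (Real.exp_pos _)]
  have hπ := Real.pi_le_four
  have hπ0 := Real.pi_pos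
  by_cases hmid : ∃ l ∈ R, 1 / 2 ≤ blockNorm l x ∧ blockNorm l x ≤ D
  · obtain ⟨l, hl, h1, h2⟩ := hmid
    have h3 : 1 / 2 ≤ ∑ l ∈ R, decayProfile D (blockNorm l x) :=
      (half_le_decayProfile h1 h2).trans
        (Finset.single_le_sum (f := fun l => decayProfile D (blockNorm l x)) (fun l _ => hg0 l) hl)
    have h4 : ‖curveIntegral x - (Real.exp (-parabolicNorm x) : ℂ)‖ ≤ 1 + 1 := by
      refine (norm_sub_le _ _).trans (add_le_add (norm_curveIntegral_le_one x) ?_)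
      rw [hexp]
      exact Real.exp_le_one_iff.2 (by linarith)
    linarith
  push Not at hmid
  have hdich : ∀ l ∈ R, blockNorm l x ≤ 1 / 2 ∨ D < blockNorm l x := fun l hl => by
    by_cases h : 1 / 2 ≤ blockNorm l x
    · exact Or.inr (hmid l hl h)
    · exact Or.inl (not_le.1 h).le
  by_cases hbig : ∃ l ∈ R, D < blockNorm l x
  -- The highest large block is taken, so that all blocks above it have norm at most `1/2`.
  · obtain ⟨l, hlmem, hlmax⟩ := (R.filter (fun l => D < blockNorm l x)).exists_max_image id
      (by obtain ⟨l, hl, h⟩ := hbig; exact ⟨l, Finset.mem_filter.2 ⟨hl, h⟩⟩)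
    obtain ⟨hlR, hlD⟩ := Finset.mem_filter.1 hlmem
    have hsmall : ∀ m ∈ R, l < m → blockNorm m x ≤ 1 / 2 := fun m hm hlm => by
      rcases hdich m hm with h | h
      · exact h
      · exact absurd (hlmax m (Finset.mem_filter.2 ⟨hm, h⟩)) (not_le.2 hlm)
    set r := blockNorm l x with hr
    have hr1 : 1 ≤ r := by linarith
    have hD2 : 2 ≤ D := by
      calc (2 : ℝ) ≤ d := hd2
        _ ≤ D := hDdef ▸ le_self_pow₀ (by linarith) (by norm_num)
    have hgl : decayProfile D r = (D / r) ^ (1 / 8 : ℝ) := decayProfile_of_ge hD1 hlD.le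
    -- Deleting the blocks above `l` brings the degree of the phase down to at most `2^l`, less than
    -- twice the degree of the large coefficient in block `l`.
    set y : E d := WithLp.toLp 2 fun i => if 2 ^ l < (i : ℕ) + 1 then 0 else x i with hy
    -- the truncated curve integral decays
    have hmain : ‖curveIntegral y‖ ≤ 320 * decayProfile D r := by
      obtain ⟨i, hi, hir⟩ := exists_blockNorm_half_pow_le x (l := l) (by linarith)
      have h1 := norm_curveIntegral_le_of_coeff (N := 2 ^ l) Nat.one_le_two_pow y
        (fun j hj => if_pos hj) i hi.1 (B := r / 2) (by linarith)
        (by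
          have : y i = x i := if_neg (not_lt.2 hi.2)
          rw [this]
          exact hir)
      have h2 : ((2 ^ l : ℕ) : ℝ) ≤ 2 * d := by
        exact_mod_cast two_pow_le_two_mul hd (Nat.lt_succ_iff.1 (Finset.mem_range.1 hlR))
      have h3 : (r / 2) ^ (-(1 / 8) : ℝ) ≤ 2 * (r ^ (1 / 8 : ℝ))⁻¹ := by
        rw [Real.rpow_neg (by positivity), Real.div_rpow (by positivity) (by norm_num), inv_div,
          div_eq_mul_inv]
        gcongr
        calc (2 : ℝ) ^ (1 / 8 : ℝ) ≤ 2 ^ (1 : ℝ) :=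
              Real.rpow_le_rpow_of_exponent_le (by norm_num) (by norm_num)
          _ = 2 := Real.rpow_one _
      calc ‖curveIntegral y‖ ≤ _ := h1
        _ ≤ 80 * (2 * d) * (2 * (r ^ (1 / 8 : ℝ))⁻¹) := by gcongr
        _ = 320 * (D / r) ^ (1 / 8 : ℝ) := by
            rw [Real.div_rpow (by positivity) (by positivity), hD8]
            ring
        _ = _ := by rw [hgl]
    have hdiff : ‖curveIntegral x - curveIntegral y‖ ≤
        4 * Real.pi * ∑ m ∈ R.filter (fun m => l < m), decayProfile D (blockNorm m x) := by
      refine (norm_curveIntegral_sub_le x y).trans ?_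
      have h1 : ∑ i, |x i - y i| =
          ∑ i ∈ Finset.univ.filter (fun i : Fin d => l < Nat.clog 2 ((i : ℕ) + 1)), |x i| := by
        rw [Finset.sum_filter]
        refine Finset.sum_congr rfl fun i _ => ?_
        simp only [hy, Nat.lt_clog_iff_pow_lt (by norm_num : 1 < 2)]
        split_ifs <;> simp
      have h2 : ∑ i ∈ Finset.univ.filter (fun i : Fin d => l < Nat.clog 2 ((i : ℕ) + 1)), |x i| ≤
          ∑ m ∈ R.filter (fun m => l < m), 2 * decayProfile D (blockNorm m x) := by
        rw [← Finset.sum_fiberwise_of_maps_to (t := R.filter (fun m => l < m))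
          (g := fun i : Fin d => Nat.clog 2 ((i : ℕ) + 1))
          (fun i hi => Finset.mem_filter.2 ⟨clog_succ_mem_range i, (Finset.mem_filter.1 hi).2⟩)]
        refine Finset.sum_le_sum fun m hm => ?_
        obtain ⟨hmR, hlm⟩ := Finset.mem_filter.1 hm
        have hs := hsmall m hmR hlm
        rw [decayProfile_of_le_one hD1 (hr0 m) (by linarith)]
        refine le_trans (Finset.sum_le_sum_of_subset_of_nonneg ?_ fun _ _ _ => abs_nonneg _)
          (sum_abs_block_le x hs)
        exact Finset.filter_subset_filter _ (Finset.subset_univ _)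
      rw [h1]
      calc 2 * Real.pi * _ ≤ 2 * Real.pi * _ := mul_le_mul_of_nonneg_left h2 (by positivity)
        _ = _ := by
            rw [← Finset.mul_sum]
            ring
    have hpois : Real.exp (-parabolicNorm x) ≤ decayProfile D r := by
      have h1 : r ≤ parabolicNorm x :=
        Finset.single_le_sum (f := fun l => blockNorm l x) (fun l _ => hr0 l) hlR
      rw [hgl]
      calc Real.exp (-parabolicNorm x) ≤ Real.exp (-r) := Real.exp_le_exp.2 (by linarith)
        _ ≤ 1 / r := by
            rw [Real.exp_neg, one_div]
            gcongr
            linarith [Real.add_one_le_exp r]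
        _ ≤ D / r := by gcongr
        _ = (D / r) ^ (1 : ℝ) := (Real.rpow_one _).symm
        _ ≤ (D / r) ^ (1 / 8 : ℝ) :=
            Real.rpow_le_rpow_of_exponent_ge (by positivity) ((div_le_one (by linarith)).2 hlD.le)
              (by norm_num)
    have hsum : decayProfile D r + ∑ m ∈ R.filter (fun m => l < m), decayProfile D (blockNorm m x) ≤
        ∑ m ∈ R, decayProfile D (blockNorm m x) := by
      rw [hr, ← Finset.sum_insert (f := fun m => decayProfile D (blockNorm m x)) (by simp)]
      refine Finset.sum_le_sum_of_subset_of_nonneg ?_ fun m _ _ => hg0 m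
      exact Finset.insert_subset hlR (Finset.filter_subset _ _)
    have hS0 : 0 ≤ ∑ m ∈ R.filter (fun m => l < m), decayProfile D (blockNorm m x) :=
      Finset.sum_nonneg fun m _ => hg0 m
    calc ‖curveIntegral x - (Real.exp (-parabolicNorm x) : ℂ)‖
        = ‖(curveIntegral x - curveIntegral y) + (curveIntegral y -
            (Real.exp (-parabolicNorm x) : ℂ))‖ := by congr 1; ring
      _ ≤ ‖curveIntegral x - curveIntegral y‖ + (‖curveIntegral y‖ +
            Real.exp (-parabolicNorm x)) := by
          refine (norm_add_le _ _).trans ?_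
          gcongr
          exact (norm_sub_le _ _).trans (by rw [hexp])
      _ ≤ 4 * 4 * ∑ m ∈ R.filter (fun m => l < m), decayProfile D (blockNorm m x) +
            (320 * decayProfile D r + decayProfile D r) := by
          refine add_le_add (hdiff.trans ?_) (add_le_add hmain hpois)
          exact mul_le_mul_of_nonneg_right (by linarith) hS0
      _ ≤ _ := by linarith [hg0 l]
  · push Not at hbig
    have hsmall : ∀ l ∈ R, blockNorm l x ≤ 1 / 2 := fun l hl =>
      (hdich l hl).resolve_right (not_lt.2 (hbig l hl))
    have hgr : ∑ l ∈ R, decayProfile D (blockNorm l x) = parabolicNorm x := by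
      rw [parabolicNorm_eq_sum_blockNorm]
      refine Finset.sum_congr rfl fun l hl => ?_
      exact decayProfile_of_le_one hD1 (hr0 l) ((hsmall l hl).trans (by norm_num))
    have hone : curveIntegral (0 : E d) = 1 := by
      simp only [curveIntegral, PiLp.zero_apply, mul_zero, neg_zero, zero_mul, Finset.sum_const_zero,
        Complex.ofReal_zero, Complex.exp_zero]
      rw [setIntegral_const, measureReal_def, volume_annulus]
      simp
    -- The value at the origin is `1` for both `σ̂` and `e^{-ρ}`; each differs from it by `O(ρ)`,
    -- and here `ρ` equals the sum of the profiles.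
    have h1 : ‖curveIntegral x - 1‖ ≤ 2 * Real.pi * (2 * parabolicNorm x) := by
      rw [← hone]
      refine (norm_curveIntegral_sub_le x 0).trans ?_
      gcongr
      rw [← Finset.sum_fiberwise_of_maps_to (s := Finset.univ) (t := R)
        (g := fun i : Fin d => Nat.clog 2 ((i : ℕ) + 1)) (fun i _ => clog_succ_mem_range i),
        parabolicNorm_eq_sum_blockNorm, Finset.mul_sum]
      refine Finset.sum_le_sum fun l hl => ?_
      simpa using sum_abs_block_le x (hsmall l hl)
    have h2 : ‖(1 : ℂ) - (Real.exp (-parabolicNorm x) : ℂ)‖ ≤ parabolicNorm x := by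
      rw [← Complex.ofReal_one, ← Complex.ofReal_sub, Complex.norm_real, Real.norm_eq_abs,
        abs_of_nonneg (by linarith [Real.exp_le_one_iff.2 (neg_nonpos.2 hρ0)])]
      linarith [Real.add_one_le_exp (-parabolicNorm x)]
    rw [hgr]
    calc ‖curveIntegral x - (Real.exp (-parabolicNorm x) : ℂ)‖
        = ‖(curveIntegral x - 1) + (1 - (Real.exp (-parabolicNorm x) : ℂ))‖ := by congr 1; ring
      _ ≤ 2 * Real.pi * (2 * parabolicNorm x) + parabolicNorm x :=
          (norm_add_le _ _).trans (add_le_add h1 h2)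
      _ ≤ 340 * parabolicNorm x := by nlinarith

/-- After a shift of `k` one may take `1 ≤ r ≤ 2`. Negative `k` contribute a geometric series with
sum `2`, the `L = 8 ⌈log₂ d⌉` scales up to `D ≤ 2^L` at most `1` each, and the remaining ones a
geometric series with ratio `2^{-1/8}`. -/
theorem tsum_decayProfile_le {d : ℕ} (r : ℝ) (hr : 0 ≤ r) :
    ∑' k : ℤ, ENNReal.ofReal (decayProfile ((d : ℝ) ^ 8) ((2 : ℝ) ^ k * r)) ≤
      ENNReal.ofReal (15 + 8 * Nat.clog 2 d) := by
  obtain ⟨D, hD⟩ : ∃ D : ℝ, D = (d : ℝ) ^ 8 := ⟨_, rfl⟩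
  obtain ⟨L, hL⟩ : ∃ L : ℕ, L = 8 * Nat.clog 2 d := ⟨_, rfl⟩
  rw [← hD]
  have hD0 : 0 ≤ D := hD ▸ by positivity
  have hDL : D ≤ 2 ^ L := by
    rw [hD, hL, mul_comm, pow_mul]
    gcongr
    exact_mod_cast Nat.le_pow_clog (by norm_num) d
  rcases hr.eq_or_lt with rfl | hr0
  · have : ∀ k : ℤ, decayProfile D ((2 : ℝ) ^ k * 0) = 0 := fun k => by
      simp [decayProfile]
    simp only [this, ENNReal.ofReal_zero, tsum_zero]
    exact zero_le
  obtain ⟨k₀, hk₀, hk₁⟩ := exists_mem_Ico_zpow hr0 (by norm_num : (1 : ℝ) < 2)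
  set u : ℝ := (2 : ℝ) ^ (-k₀) * r with hu
  have hu1 : 1 ≤ u := by
    rw [hu, zpow_neg, inv_mul_eq_div, one_le_div (by positivity)]
    exact hk₀
  have hu2 : u ≤ 2 := by
    rw [hu, zpow_neg, inv_mul_eq_div, div_le_iff₀ (by positivity), mul_comm,
      ← zpow_add_one₀ (by norm_num)]
    exact hk₁.le
  rw [← (Equiv.subRight k₀).tsum_eq]
  have hshift : ∀ k : ℤ, (2 : ℝ) ^ (Equiv.subRight k₀ k) * r = (2 : ℝ) ^ k * u := fun k => by
    rw [hu, Equiv.subRight_apply, sub_eq_add_neg, zpow_add₀ (by norm_num), mul_assoc]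
  simp only [hshift]
  rw [tsum_of_nat_of_neg_add_one ENNReal.summable ENNReal.summable]
  have hneg : ∑' n : ℕ, ENNReal.ofReal (decayProfile D ((2 : ℝ) ^ (-((n : ℤ) + 1)) * u)) ≤
      ENNReal.ofReal 2 := by
    calc _ ≤ ∑' n : ℕ, ENNReal.ofReal ((1 / 2) ^ n) := by
          refine ENNReal.tsum_le_tsum fun n => ENNReal.ofReal_le_ofReal ?_
          refine (min_le_left _ _).trans ?_
          rw [zpow_neg, ← Nat.cast_succ, zpow_natCast, pow_succ, one_div, inv_pow, mul_inv]
          have : (0 : ℝ) < (2 ^ n)⁻¹ := by positivity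
          nlinarith
      _ = ENNReal.ofReal 2 := by
          rw [← ENNReal.ofReal_tsum_of_nonneg (fun n => by positivity) summable_geometric_two,
            tsum_geometric_two]
  have hpos : ∑' n : ℕ, ENNReal.ofReal (decayProfile D ((2 : ℝ) ^ (n : ℤ) * u)) ≤
      ENNReal.ofReal L + ENNReal.ofReal 13 := by
    rw [← ENNReal.summable.sum_add_tsum_nat_add' (k := L)]
    refine add_le_add ?_ ?_
    · calc ∑ n ∈ Finset.range L, ENNReal.ofReal (decayProfile D ((2 : ℝ) ^ (n : ℤ) * u))
          ≤ ∑ n ∈ Finset.range L, 1 := by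
            refine Finset.sum_le_sum fun n _ => ?_
            rw [← ENNReal.ofReal_one]
            exact ENNReal.ofReal_le_ofReal ((min_le_right _ _).trans (min_le_left _ _))
        _ = ENNReal.ofReal L := by simp
    -- A rational upper bound for `2^{-1/8}`; the series with ratio `12/13` sums to `13`.
    · have hq : ((1 / 2 : ℝ)) ^ (1 / 8 : ℝ) ≤ 12 / 13 := by
        rw [← Real.rpow_le_rpow_iff (z := 8) (by positivity) (by positivity) (by norm_num),
          ← Real.rpow_mul (by norm_num)]
        norm_num
      calc ∑' n : ℕ, ENNReal.ofReal (decayProfile D ((2 : ℝ) ^ ((n + L : ℕ) : ℤ) * u))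
          ≤ ∑' n : ℕ, ENNReal.ofReal ((12 / 13) ^ n) := by
            refine ENNReal.tsum_le_tsum fun n => ENNReal.ofReal_le_ofReal ?_
            refine ((min_le_right _ _).trans (min_le_right _ _)).trans ?_
            calc (D / ((2 : ℝ) ^ ((n + L : ℕ) : ℤ) * u)) ^ (1 / 8 : ℝ)
                ≤ ((1 / 2) ^ n) ^ (1 / 8 : ℝ) := by
                  gcongr
                  rw [zpow_natCast, pow_add, div_le_iff₀ (by positivity), one_div, inv_pow]
                  have : ((2 : ℝ) ^ n)⁻¹ * (2 ^ n * 2 ^ L * u) = 2 ^ L * u := by field_simp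
                  rw [this]
                  nlinarith [pow_pos (two_pos (α := ℝ)) L]
              _ = ((1 / 2) ^ (1 / 8 : ℝ)) ^ n := by
                  rw [← Real.rpow_natCast, ← Real.rpow_natCast, ← Real.rpow_mul (by norm_num),
                    ← Real.rpow_mul (by norm_num), mul_comm]
              _ ≤ _ := by gcongr
        _ = ENNReal.ofReal 13 := by
            rw [← ENNReal.ofReal_tsum_of_nonneg (fun n => by positivity)
              (summable_geometric_of_lt_one (by norm_num) (by norm_num)),
              tsum_geometric_of_lt_one (by norm_num) (by norm_num)]
            norm_num
  calc _ ≤ (ENNReal.ofReal L + ENNReal.ofReal 13) + ENNReal.ofReal 2 := add_le_add hpos hneg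
    _ = _ := by
        rw [← ENNReal.ofReal_add (by positivity) (by norm_num),
          ← ENNReal.ofReal_add (by positivity) (by norm_num), hL]
        congr 1
        push_cast
        ring

/-- The square sum of the multipliers of the square function. -/
theorem exists_tsum_multiplier_sq_le : ∃ c : ℝ, 0 < c ∧ ∀ d : ℕ, 2 ≤ d → ∀ x : E d,
    ∑' k : ℤ, ‖curveIntegral (dilation ((2 : ℝ) ^ k) x) -
      (Real.exp (-parabolicNorm (dilation ((2 : ℝ) ^ k) x)) : ℂ)‖ₑ ^ 2 ≤
      ENNReal.ofReal ((c * Real.log d) ^ 2) := by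
  -- `750 = 250 · 3`: the total is at most `(250 n)²` for `n ≥ 1`, and `n ≤ 3 log d` follows from
  -- `2^n ≤ 2d ≤ d²`.
  refine ⟨750, by norm_num, fun d hd x => ?_⟩
  set R := Finset.range (Nat.clog 2 d + 1) with hR
  set n := Nat.clog 2 d with hn
  have hd2 : (2 : ℝ) ≤ d := by exact_mod_cast hd
  have hn1 : (1 : ℝ) ≤ n := by
    have : 1 ≤ n := Nat.clog_pos (by norm_num) hd
    exact_mod_cast this
  have hD0 : (0 : ℝ) ≤ (d : ℝ) ^ 8 := by positivity
  have hnlog : (n : ℝ) ≤ 3 * Real.log d := by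
    have h1 : (2 : ℝ) ^ n ≤ d ^ 2 := by
      have : 2 ^ n ≤ 2 * d := two_pow_le_two_mul hd le_rfl
      have h2 : ((2 ^ n : ℕ) : ℝ) ≤ ((2 * d : ℕ) : ℝ) := by exact_mod_cast this
      push_cast at h2
      nlinarith
    have h2 := Real.log_le_log (by positivity) h1
    rw [Real.log_pow, Real.log_pow] at h2
    have h3 := Real.log_two_gt_d9
    push_cast at h2
    nlinarith
  -- Since `‖w‖ ≤ 2`, one has `‖w‖² ≤ 2‖w‖`, whence `680 = 2 · 340`. The bound becomes linear in the
  -- profiles and the blocks separate.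
  have hpt : ∀ k : ℤ, ‖curveIntegral (dilation ((2 : ℝ) ^ k) x) -
      (Real.exp (-parabolicNorm (dilation ((2 : ℝ) ^ k) x)) : ℂ)‖ₑ ^ 2 ≤
      ∑ l ∈ R, ENNReal.ofReal 680 *
        ENNReal.ofReal (decayProfile ((d : ℝ) ^ 8) ((2 : ℝ) ^ k * blockNorm l x)) := fun k => by
    have h1 := norm_curveIntegral_sub_exp_le hd (dilation ((2 : ℝ) ^ k) x)
    simp only [blockNorm_dilation _ (zpow_pos (two_pos (α := ℝ)) k)] at h1
    set w := curveIntegral (dilation ((2 : ℝ) ^ k) x) -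
      (Real.exp (-parabolicNorm (dilation ((2 : ℝ) ^ k) x)) : ℂ) with hw
    have h2 : ‖w‖ ≤ 1 + 1 := by
      refine (norm_sub_le _ _).trans (add_le_add (norm_curveIntegral_le_one _) ?_)
      rw [Complex.norm_real, Real.norm_eq_abs, abs_of_pos (Real.exp_pos _)]
      exact Real.exp_le_one_iff.2 (neg_nonpos.2 (parabolicNorm_nonneg _))
    rw [← Finset.mul_sum, ← ENNReal.ofReal_sum_of_nonneg fun l _ => decayProfile_nonneg hD0
      (mul_nonneg (zpow_pos two_pos k).le (blockNorm_nonneg _ _)),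
      ← ENNReal.ofReal_mul (by norm_num), ← ofReal_norm, ← ENNReal.ofReal_pow (norm_nonneg _)]
    refine ENNReal.ofReal_le_ofReal ?_
    nlinarith [norm_nonneg w]
  calc _ ≤ ∑' k : ℤ, ∑ l ∈ R, ENNReal.ofReal 680 *
        ENNReal.ofReal (decayProfile ((d : ℝ) ^ 8) ((2 : ℝ) ^ k * blockNorm l x)) :=
        ENNReal.tsum_le_tsum hpt
    _ = ∑ l ∈ R, ENNReal.ofReal 680 * ∑' k : ℤ,
        ENNReal.ofReal (decayProfile ((d : ℝ) ^ 8) ((2 : ℝ) ^ k * blockNorm l x)) := by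
        rw [Summable.tsum_finsetSum fun _ _ => ENNReal.summable]
        simp only [ENNReal.tsum_mul_left]
    _ ≤ ∑ l ∈ R, ENNReal.ofReal 680 * ENNReal.ofReal (15 + 8 * n) := by
        gcongr with l
        exact tsum_decayProfile_le _ (blockNorm_nonneg _ _)
    _ = ENNReal.ofReal ((n + 1) * (680 * (15 + 8 * n))) := by
        rw [Finset.sum_const, hR, Finset.card_range, nsmul_eq_mul, ← ENNReal.ofReal_natCast,
          ← ENNReal.ofReal_mul (by norm_num), ← ENNReal.ofReal_mul (by positivity)]
        push_cast
        rfl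
    _ ≤ _ := by
        refine ENNReal.ofReal_le_ofReal ?_
        have h1 : (n + 1) * (680 * (15 + 8 * n)) ≤ (250 * n : ℝ) ^ 2 := by nlinarith
        exact h1.trans (pow_le_pow_left₀ (by positivity) (by linarith) 2)

/-! ### Convolution with finite measures on `L²` -/

section

variable {V : Type*} [NormedAddCommGroup V] [InnerProductSpace ℝ V] [MeasurableSpace V]
  [BorelSpace V] [FiniteDimensional ℝ V]

theorem eLpNorm_two_sq {α : Type*} [MeasurableSpace α] (μ : Measure α) (f : α → ℂ) :
    eLpNorm f 2 μ ^ 2 = ∫⁻ x, ‖f x‖ₑ ^ 2 ∂μ := by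
  have := eLpNorm_nnreal_pow_eq_lintegral (μ := μ) (f := f) (p := 2) (by norm_num)
  simpa using this

theorem integral_fourier_mul_eq {f g : V → ℂ} (hf : Integrable f) (hg : Integrable g) :
    ∫ ξ, 𝓕 f ξ * g ξ = ∫ x, f x * 𝓕 g x := by
  have := VectorFourier.integral_fourierIntegral_smul_eq_flip (L := innerₗ V)
    Real.continuous_fourierChar continuous_inner hf hg
  rwa [flip_innerₗ] at this

theorem integral_fourierInv_mul_eq {f g : V → ℂ} (hf : Integrable f) (hg : Integrable g) :
    ∫ ξ, 𝓕⁻ f ξ * g ξ = ∫ x, f x * 𝓕⁻ g x := by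
  rw [Real.fourierInv_eq_fourier_comp_neg, integral_fourier_mul_eq hf.comp_neg hg,
    ← integral_neg_eq_self]
  simp only [neg_neg, ← Real.fourierInv_eq_fourier_neg]

/-- The `L²` inverse Fourier transform is given by the integral on `L¹ ∩ L²`. -/
theorem coeFn_fourierInv_toLp {G : V → ℂ} (h1 : Integrable G) (h2 : MemLp G 2) :
    ((𝓕⁻ (h2.toLp G) : Lp ℂ 2 (volume : Measure V)) : V → ℂ) =ᵐ[volume] 𝓕⁻ G := by
  set H : Lp ℂ 2 (volume : Measure V) := 𝓕⁻ (h2.toLp G) with hH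
  have hcont : Continuous (𝓕⁻ G) := by
    rw [Real.fourierInv_eq_fourier_comp_neg]
    exact VectorFourier.fourierIntegral_continuous Real.continuous_fourierChar
      (by exact continuous_inner) h1.comp_neg
  have hloc : LocallyIntegrable (H : V → ℂ) :=
    (Lp.memLp H).locallyIntegrable (by norm_num)
  -- Both sides are locally integrable, so it suffices to test against smooth compactly supported
  -- functions. These are Schwartz, and the `L²` transform agrees with that of tempered
  -- distributions.
  refine ae_eq_of_integral_contDiff_smul_eq hloc hcont.locallyIntegrable fun g hg hgc => ?_
  have hgc' : HasCompactSupport (fun x => (g x : ℂ)) := hgc.comp_left Complex.ofReal_zero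
  set φ : SchwartzMap V ℂ := hgc'.toSchwartzMap
    (Complex.ofRealCLM.contDiff.comp hg) with hφ
  have hφx : ∀ x, φ x = g x := fun x => rfl
  have e1 : ∫ x, φ x • (H : V → ℂ) x = ∫ x, (𝓕⁻ φ) x • G x := by
    rw [← Lp.toTemperedDistribution_apply, hH, ← Lp.fourierInv_toTemperedDistribution_eq,
      TemperedDistribution.fourierInv_apply, Lp.toTemperedDistribution_apply]
    refine integral_congr_ae ?_
    filter_upwards [h2.coeFn_toLp] with x hx
    rw [hx]
  have e2 : ∫ x, (𝓕⁻ φ) x • G x = ∫ x, φ x * 𝓕⁻ G x := by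
    rw [SchwartzMap.fourierInv_coe]
    exact integral_fourierInv_mul_eq φ.integrable h1
  have := e1.trans e2
  simpa only [hφx, smul_eq_mul, Complex.real_smul] using this

/-- The convolution of a function and a measure. -/
noncomputable def measureConv (A : Measure V) (f : V → ℂ) (x : V) : ℂ := ∫ y, f (x - y) ∂A

/-- The Fourier transform of a measure. -/
noncomputable def fourierMeasure (A : Measure V) (ξ : V) : ℂ :=
  ∫ y, Complex.exp ((-(2 * Real.pi * inner ℝ y ξ) : ℝ) * Complex.I) ∂A

theorem aestronglyMeasurable_sub_prod (A : Measure V) [IsFiniteMeasure A] {f : V → ℂ}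
    (hf : AEStronglyMeasurable f) :
    AEStronglyMeasurable (fun p : V × V => f (p.1 - p.2)) (volume.prod A) :=
  hf.comp_quasiMeasurePreserving (quasiMeasurePreserving_sub_of_right_invariant volume A)

theorem lintegral_lintegral_enorm_sq (A : Measure V) [IsFiniteMeasure A] {f : V → ℂ}
    (hf : AEStronglyMeasurable f) :
    ∫⁻ x, ∫⁻ y, ‖f (x - y)‖ₑ ^ 2 ∂A = A Set.univ * ∫⁻ x, ‖f x‖ₑ ^ 2 := by
  rw [lintegral_lintegral_swap ((aestronglyMeasurable_sub_prod A hf).enorm.pow_const 2)]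
  simp only [lintegral_sub_right_eq_self (fun x => ‖f x‖ₑ ^ 2), lintegral_const]
  rw [mul_comm]

/-- By Tonelli `f(x - ·)` lies in `L²(A)` for almost every `x`, hence in `L¹(A)` because `A` is
finite. -/
theorem ae_integrable_sub (A : Measure V) [IsFiniteMeasure A] {f : V → ℂ} (hf : MemLp f 2) :
    ∀ᵐ x, Integrable (fun y => f (x - y)) A := by
  have hm := aestronglyMeasurable_sub_prod A hf.1
  have hfin : ∫⁻ x, ∫⁻ y, ‖f (x - y)‖ₑ ^ 2 ∂A ≠ ∞ := by
    rw [lintegral_lintegral_enorm_sq A hf.1, ← eLpNorm_two_sq]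
    exact ENNReal.mul_ne_top (measure_ne_top _ _) (ENNReal.pow_ne_top hf.2.ne)
  filter_upwards [hm.prodMk_left, ae_lt_top' (hm.enorm.pow_const 2).lintegral_prod_right' hfin]
    with x hx hx2
  refine MemLp.integrable (q := 2) (by norm_num) ⟨hx, ?_⟩
  rw [← eLpNorm_two_sq] at hx2
  exact lt_top_iff_ne_top.2 fun h => by simp [h] at hx2

theorem aestronglyMeasurable_measureConv (A : Measure V) [IsFiniteMeasure A] {f : V → ℂ}
    (hf : AEStronglyMeasurable f) : AEStronglyMeasurable (measureConv A f) :=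
  (aestronglyMeasurable_sub_prod A hf).integral_prod_right'

/-- Cauchy–Schwarz in `y`, then Tonelli and translation invariance. -/
theorem eLpNorm_measureConv_le (A : Measure V) [IsFiniteMeasure A] {f : V → ℂ}
    (hf : AEStronglyMeasurable f) :
    eLpNorm (measureConv A f) 2 volume ≤ A Set.univ * eLpNorm f 2 volume := by
  have hm := aestronglyMeasurable_sub_prod A hf
  rw [← ENNReal.pow_le_pow_left_iff (n := 2) two_ne_zero, eLpNorm_two_sq, mul_pow, eLpNorm_two_sq]
  have hpt : ∀ᵐ x, ‖measureConv A f x‖ₑ ^ 2 ≤ A Set.univ * ∫⁻ y, ‖f (x - y)‖ₑ ^ 2 ∂A := by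
    filter_upwards [hm.prodMk_left] with x hx
    have h1 : ‖measureConv A f x‖ₑ ≤ eLpNorm (fun y => f (x - y)) 1 A := by
      rw [eLpNorm_one_eq_lintegral_enorm]
      exact enorm_integral_le_lintegral_enorm _
    have h2 := eLpNorm_le_eLpNorm_mul_rpow_measure_univ (p := 1) (q := 2) (by norm_num) hx
    have h3 : (A Set.univ ^ (1 / (1 : ℝ≥0∞).toReal - 1 / (2 : ℝ≥0∞).toReal)) ^ 2 = A Set.univ := by
      rw [← ENNReal.rpow_natCast, ← ENNReal.rpow_mul]
      norm_num
    calc ‖measureConv A f x‖ₑ ^ 2 ≤ _ := pow_le_pow_left' (h1.trans h2) 2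
      _ = _ := by rw [mul_pow, h3, eLpNorm_two_sq, mul_comm]
  calc ∫⁻ x, ‖measureConv A f x‖ₑ ^ 2 ≤ ∫⁻ x, A Set.univ * ∫⁻ y, ‖f (x - y)‖ₑ ^ 2 ∂A :=
        lintegral_mono_ae hpt
    _ = A Set.univ * ∫⁻ x, ∫⁻ y, ‖f (x - y)‖ₑ ^ 2 ∂A :=
        lintegral_const_mul' _ _ (measure_ne_top _ _)
    _ = _ := by
        rw [lintegral_lintegral_enorm_sq A hf]
        ring

theorem memLp_measureConv (A : Measure V) [IsFiniteMeasure A] {f : V → ℂ} (hf : MemLp f 2) :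
    MemLp (measureConv A f) 2 :=
  ⟨aestronglyMeasurable_measureConv A hf.1, (eLpNorm_measureConv_le A hf.1).trans_lt
    (ENNReal.mul_lt_top (measure_lt_top _ _) hf.2)⟩

theorem measureConv_add_ae (A : Measure V) [IsFiniteMeasure A] {f g : V → ℂ} (hf : MemLp f 2)
    (hg : MemLp g 2) : measureConv A (f + g) =ᵐ[volume] measureConv A f + measureConv A g := by
  filter_upwards [ae_integrable_sub A hf, ae_integrable_sub A hg] with x h1 h2
  exact integral_add h1 h2

theorem measureConv_congr_ae (A : Measure V) [IsFiniteMeasure A] {f g : V → ℂ}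
    (h : f =ᵐ[volume] g) : measureConv A f =ᵐ[volume] measureConv A g := by
  have h1 := (quasiMeasurePreserving_sub_of_right_invariant (volume : Measure V) A).ae_eq_comp h
  filter_upwards [Measure.ae_ae_of_ae_prod h1] with x hx
  exact integral_congr_ae hx

/-- Convolution with a finite measure as a bounded operator on `L²`. -/
noncomputable def measureConvCLM (A : Measure V) [IsFiniteMeasure A] :
    Lp ℂ 2 (volume : Measure V) →L[ℝ] Lp ℂ 2 (volume : Measure V) :=
  LinearMap.mkContinuous
    { toFun f := (memLp_measureConv A (Lp.memLp f)).toLp _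
      map_add' f g := by
        rw [← MemLp.toLp_add]
        exact MemLp.toLp_congr _ _ ((measureConv_congr_ae A (Lp.coeFn_add f g)).trans
          (measureConv_add_ae A (Lp.memLp f) (Lp.memLp g)))
      map_smul' c f := by
        rw [RingHom.id_apply, ← MemLp.toLp_const_smul]
        refine MemLp.toLp_congr _ _ ((measureConv_congr_ae A (Lp.coeFn_smul c f)).trans ?_)
        exact Filter.Eventually.of_forall fun x => integral_smul c _ }
    (A Set.univ).toReal fun f => by
      simp only [LinearMap.coe_mk, AddHom.coe_mk]
      rw [Lp.norm_toLp, Lp.norm_def, ← ENNReal.toReal_mul]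
      exact ENNReal.toReal_mono (ENNReal.mul_ne_top (measure_ne_top _ _) (Lp.eLpNorm_ne_top f))
        (eLpNorm_measureConv_le A (Lp.memLp f).1)

theorem coeFn_measureConvCLM (A : Measure V) [IsFiniteMeasure A] {f : V → ℂ} (hf : MemLp f 2) :
    (measureConvCLM A (hf.toLp f) : V → ℂ) =ᵐ[volume] measureConv A f :=
  (MemLp.coeFn_toLp (memLp_measureConv A (Lp.memLp (hf.toLp f)))).trans
    (measureConv_congr_ae A hf.coeFn_toLp)

theorem norm_fourierMeasure_le (A : Measure V) [IsFiniteMeasure A] (ξ : V) :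
    ‖fourierMeasure A ξ‖ ≤ A.real Set.univ := by
  have := norm_integral_le_of_norm_le_const (μ := A) (C := 1)
    (f := fun y => Complex.exp ((-(2 * Real.pi * inner ℝ y ξ) : ℝ) * Complex.I))
    (Filter.Eventually.of_forall fun y => (Complex.norm_exp_ofReal_mul_I _).le)
  simpa [fourierMeasure] using this

theorem continuous_fourierMeasure (A : Measure V) [IsFiniteMeasure A] :
    Continuous (fourierMeasure A) := by
  refine continuous_of_dominated (bound := fun _ => 1) (fun ξ => ?_) (fun ξ => ?_) (by simp) ?_
  · exact (by fun_prop : Continuous _).aestronglyMeasurable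
  · exact Filter.Eventually.of_forall fun y => (Complex.norm_exp_ofReal_mul_I _).le
  · exact Filter.Eventually.of_forall fun y => by fun_prop

/-- Insert Fourier inversion for `f` and exchange the integrals; `𝓕 f` is integrable and `A` is
finite. -/
theorem measureConv_schwartz (A : Measure V) [IsFiniteMeasure A] (f : SchwartzMap V ℂ) (x : V) :
    measureConv A f x = 𝓕⁻ (fun ξ => fourierMeasure A ξ * 𝓕 f ξ) x := by
  have hinv : ∀ z, f z = ∫ ξ, Complex.exp ((2 * Real.pi * inner ℝ ξ z : ℝ) * Complex.I) *
      (𝓕 f) ξ := fun z => by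
    have h1 : 𝓕⁻ (𝓕 f) z = f z := by rw [FourierTransform.fourierInv_fourier_eq]
    rw [← h1, SchwartzMap.fourierInv_coe, Real.fourierInv_eq']
    rfl
  rw [Real.fourierInv_eq']
  simp only [smul_eq_mul, measureConv, hinv, fourierMeasure]
  rw [integral_integral_swap]
  · refine integral_congr_ae (Filter.Eventually.of_forall fun ξ => ?_)
    simp only
    rw [← integral_mul_const, ← integral_const_mul]
    refine integral_congr_ae (Filter.Eventually.of_forall fun y => ?_)
    simp only
    rw [← mul_assoc, ← Complex.exp_add]
    congr 2
    rw [inner_sub_right, real_inner_comm ξ y]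
    push_cast
    ring
  · have h2 : Integrable (fun p : V × V => (𝓕 f) p.2) (A.prod volume) :=
      (SchwartzMap.integrable (𝓕 f)).comp_snd A
    refine h2.mono ?_ ?_
    · refine AEStronglyMeasurable.mul ?_ h2.1
      exact (by fun_prop : Continuous _).aestronglyMeasurable
    · refine Filter.Eventually.of_forall fun p => ?_
      rw [Function.uncurry_def]
      simp only
      rw [norm_mul, Complex.norm_exp_ofReal_mul_I, one_mul]

theorem memLp_fourierMeasure_mul (A : Measure V) [IsFiniteMeasure A] (f : SchwartzMap V ℂ)
    (p : ℝ≥0∞) : MemLp (fun ξ => fourierMeasure A ξ * f ξ) p := by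
  refine (f.memLp p volume).of_le_mul (c := A.real Set.univ) ?_ ?_
  · exact ((continuous_fourierMeasure A).mul f.continuous).aestronglyMeasurable
  · refine Filter.Eventually.of_forall fun ξ => ?_
    rw [norm_mul]
    gcongr
    exact norm_fourierMeasure_le A ξ

theorem measureConvCLM_schwartz (A : Measure V) [IsFiniteMeasure A] (f : SchwartzMap V ℂ) :
    measureConvCLM A (f.toLp 2) = 𝓕⁻ ((memLp_fourierMeasure_mul A (𝓕 f) 2).toLp _) := by
  refine Lp.ext ((coeFn_measureConvCLM A (f.memLp 2 volume)).trans ?_)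
  refine Filter.EventuallyEq.trans ?_ (coeFn_fourierInv_toLp
    (memLp_one_iff_integrable.1 (memLp_fourierMeasure_mul A (𝓕 f) 1)) _).symm
  exact Filter.Eventually.of_forall (measureConv_schwartz A f)

-- Plancherel: on Schwartz functions both operators are Fourier multipliers, and the `L²` Fourier
-- transform is an isometry.
set_option maxHeartbeats 1000000 in
theorem enorm_measureConvCLM_sub_schwartz (A B : Measure V) [IsFiniteMeasure A] [IsFiniteMeasure B]
    (f : SchwartzMap V ℂ) :
    ‖measureConvCLM A (f.toLp 2) - measureConvCLM B (f.toLp 2)‖ₑ ^ 2 =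
      ∫⁻ ξ, ‖fourierMeasure A ξ - fourierMeasure B ξ‖ₑ ^ 2 * ‖(𝓕 f) ξ‖ₑ ^ 2 := by
  obtain ⟨a, ha⟩ : ∃ a : Lp ℂ 2 (volume : Measure V),
    a = (memLp_fourierMeasure_mul A (𝓕 f) 2).toLp _ := ⟨_, rfl⟩
  obtain ⟨b, hb⟩ : ∃ b : Lp ℂ 2 (volume : Measure V),
    b = (memLp_fourierMeasure_mul B (𝓕 f) 2).toLp _ := ⟨_, rfl⟩
  obtain ⟨S, hS⟩ : ∃ S : Lp ℂ 2 (volume : Measure V) ≃ₗᵢ[ℂ] Lp ℂ 2 (volume : Measure V),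
    S = (Lp.fourierTransformₗᵢ V ℂ).symm := ⟨_, rfl⟩
  have h1 : measureConvCLM A (f.toLp 2) = S a := by
    rw [measureConvCLM_schwartz, ← ha, hS]
    rfl
  have h2 : measureConvCLM B (f.toLp 2) = S b := by
    rw [measureConvCLM_schwartz, ← hb, hS]
    rfl
  have h3 : ‖S a - S b‖ₑ = ‖a - b‖ₑ := by
    rw [← S.map_sub, ← ofReal_norm, ← ofReal_norm, S.norm_map]
  have h4 : a - b = ((memLp_fourierMeasure_mul A (𝓕 f) 2).sub
      (memLp_fourierMeasure_mul B (𝓕 f) 2)).toLp _ := by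
    rw [ha, hb]
    exact (MemLp.toLp_sub _ _).symm
  rw [h1, h2, h3, h4, Lp.enorm_toLp, eLpNorm_two_sq]
  refine lintegral_congr fun ξ => ?_
  rw [Pi.sub_apply, ← sub_mul, enorm_mul, mul_pow]

theorem enorm_sq_toLp {f : V → ℂ} (hf : MemLp f 2) :
    ‖hf.toLp f‖ₑ ^ 2 = ∫⁻ x, ‖f x‖ₑ ^ 2 := by
  rw [Lp.enorm_toLp, eLpNorm_two_sq]

/-- Integrating the symbol bound gives the inequality for Schwartz functions. For a finite index set
both sides are continuous on `L²`, so density extends it; infinite families follow by taking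
suprema. -/
theorem sum_enorm_measureConvCLM_sub_le {ι : Type*} (A B : ι → Measure V)
    [∀ k, IsFiniteMeasure (A k)] [∀ k, IsFiniteMeasure (B k)] (s : Finset ι) {K : ℝ≥0∞}
    (hK : K ≠ ∞)
    (h : ∀ ξ, ∑ k ∈ s, ‖fourierMeasure (A k) ξ - fourierMeasure (B k) ξ‖ₑ ^ 2 ≤ K)
    (F : Lp ℂ 2 (volume : Measure V)) :
    ∑ k ∈ s, ‖measureConvCLM (A k) F - measureConvCLM (B k) F‖ₑ ^ 2 ≤ K * ‖F‖ₑ ^ 2 := by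
  refine DenseRange.induction_on (p := fun F : Lp ℂ 2 (volume : Measure V) =>
    ∑ k ∈ s, ‖measureConvCLM (A k) F - measureConvCLM (B k) F‖ₑ ^ 2 ≤ K * ‖F‖ₑ ^ 2)
    (SchwartzMap.denseRange_toLpCLM (E := V) (F := ℂ) (p := 2) ENNReal.ofNat_ne_top) F ?_ ?_
  · refine isClosed_le ?_ ?_
    · refine continuous_finsetSum _ fun k _ => (ENNReal.continuous_pow 2).comp ?_
      exact continuous_enorm.comp
        ((measureConvCLM (A k)).continuous.sub (measureConvCLM (B k)).continuous)
    · exact (ENNReal.continuous_const_mul hK).comp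
        ((ENNReal.continuous_pow 2).comp continuous_enorm)
  · intro f
    rw [SchwartzMap.toLpCLM_apply]
    simp only [enorm_measureConvCLM_sub_schwartz]
    have hm : ∀ k, Measurable fun ξ =>
        ‖fourierMeasure (A k) ξ - fourierMeasure (B k) ξ‖ₑ ^ 2 * ‖(𝓕 f) ξ‖ₑ ^ 2 := fun k =>
      (((continuous_fourierMeasure (A k)).sub (continuous_fourierMeasure (B k))).measurable.enorm.pow_const
        2).mul ((𝓕 f).continuous.measurable.enorm.pow_const 2)
    have hnorm : ‖f.toLp 2 volume‖ₑ ^ 2 = ∫⁻ ξ, ‖(𝓕 f) ξ‖ₑ ^ 2 := by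
      rw [← enorm_sq_toLp ((𝓕 f).memLp 2 volume)]
      congr 1
      change _ = ‖(𝓕 f).toLp 2 volume‖ₑ
      rw [← SchwartzMap.toLp_fourier_eq]
      exact ((Lp.fourierTransformₗᵢ V ℂ).enorm_map _).symm
    rw [← lintegral_finsetSum _ fun k _ => hm k, hnorm, ← lintegral_const_mul _
      ((𝓕 f).continuous.measurable.enorm.pow_const 2)]
    refine lintegral_mono fun ξ => ?_
    rw [← Finset.sum_mul]
    gcongr
    exact h ξ

/-- The square function of a family of differences of finite measures is bounded on `L²` by the
supremum of the square sum of their Fourier transforms. -/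
theorem lintegral_tsum_measureConv_sub_le {ι : Type*} [Countable ι] (A B : ι → Measure V)
    [∀ k, IsFiniteMeasure (A k)] [∀ k, IsFiniteMeasure (B k)] {K : ℝ≥0∞} (hK : K ≠ ∞)
    (h : ∀ ξ, ∑' k, ‖fourierMeasure (A k) ξ - fourierMeasure (B k) ξ‖ₑ ^ 2 ≤ K)
    {f : V → ℂ} (hf : MemLp f 2) :
    ∫⁻ x, ∑' k, ‖measureConv (A k) f x - measureConv (B k) f x‖ₑ ^ 2 ≤
      K * ∫⁻ x, ‖f x‖ₑ ^ 2 := by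
  have hm : ∀ k, AEStronglyMeasurable (fun x => measureConv (A k) f x - measureConv (B k) f x) :=
    fun k => (aestronglyMeasurable_measureConv (A k) hf.1).sub
      (aestronglyMeasurable_measureConv (B k) hf.1)
  rw [lintegral_tsum fun k => (hm k).enorm.pow_const 2, ENNReal.tsum_eq_iSup_sum]
  refine iSup_le fun s => ?_
  have key := sum_enorm_measureConvCLM_sub_le A B s hK
    (fun ξ => (ENNReal.sum_le_tsum s).trans (h ξ)) (hf.toLp f)
  rw [enorm_sq_toLp] at key
  refine le_trans (Finset.sum_le_sum fun k _ => le_of_eq ?_) key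
  rw [Lp.enorm_def, eLpNorm_two_sq]
  refine lintegral_congr_ae ?_
  filter_upwards [Lp.coeFn_sub (measureConvCLM (A k) (hf.toLp f)) (measureConvCLM (B k) (hf.toLp f)),
    coeFn_measureConvCLM (A k) hf, coeFn_measureConvCLM (B k) hf] with x h1 h2 h3
  rw [h1, Pi.sub_apply, h2, h3]

end

/-! ### Positive definite and conditionally negative definite functions -/

section PosDef

open Matrix

theorem posSemidef_iff_sum_nonneg {n : ℕ} {M : Matrix (Fin n) (Fin n) ℝ}
    (hM : ∀ i j, M i j = M j i) :
    M.PosSemidef ↔ ∀ c : Fin n → ℝ, 0 ≤ ∑ i, ∑ j, c i * c j * M i j := by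
  have hherm : M.IsHermitian := by
    ext i j
    simp [hM i j]
  have hsum : ∀ c : Fin n → ℝ, star c ⬝ᵥ M *ᵥ c = ∑ i, ∑ j, c i * c j * M i j := fun c => by
    simp only [dotProduct, mulVec, Finset.mul_sum, Pi.star_apply, star_trivial]
    exact Finset.sum_congr rfl fun i _ => Finset.sum_congr rfl fun j _ => by ring
  rw [posSemidef_iff_dotProduct_mulVec]
  simp only [hsum]
  exact and_iff_right hherm

theorem _root_.Matrix.PosSemidef.map_pow {n : ℕ} {M : Matrix (Fin n) (Fin n) ℝ} (hM : M.PosSemidef)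
    (k : ℕ) : (M.map (· ^ k)).PosSemidef := by
  induction k with
  | zero =>
    have : M.map (· ^ 0) = vecMulVec (fun _ => (1 : ℝ)) (star fun _ => (1 : ℝ)) := by
      ext i j
      simp [vecMulVec_apply]
    rw [this]
    exact posSemidef_vecMulVec_self_star _
  | succ k ih =>
    have : M.map (· ^ (k + 1)) = M.map (· ^ k) ⊙ M := by
      ext i j
      simp [pow_succ]
    rw [this]
    exact ih.hadamard hM

/-- Entrywise powers are positive semidefinite by the Schur product theorem, and the exponential
series has nonnegative coefficients. -/
theorem sum_mul_exp_nonneg {n : ℕ} {M : Matrix (Fin n) (Fin n) ℝ} (hM : M.PosSemidef)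
    (c : Fin n → ℝ) : 0 ≤ ∑ i, ∑ j, c i * c j * Real.exp (M i j) := by
  have hsymm : ∀ i j, M i j = M j i := fun i j => by simpa using hM.isHermitian.apply j i
  have hs : HasSum (fun k : ℕ => ∑ i, ∑ j, c i * c j * (M i j ^ k / (k.factorial : ℝ)))
      (∑ i, ∑ j, c i * c j * Real.exp (M i j)) := by
    refine hasSum_sum fun i _ => hasSum_sum fun j _ => HasSum.mul_left _ ?_
    rw [Real.exp_eq_exp_ℝ]
    exact NormedSpace.expSeries_div_hasSum_exp (M i j)
  refine hs.nonneg fun k => ?_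
  have h1 := (posSemidef_iff_sum_nonneg (M := M.map (· ^ k)) fun i j => by simp [hsymm i j]).1
    (hM.map_pow k) c
  have h2 : ∑ i, ∑ j, c i * c j * (M i j ^ k / (k.factorial : ℝ)) =
      (∑ i, ∑ j, c i * c j * M.map (· ^ k) i j) / (k.factorial : ℝ) := by
    rw [Finset.sum_div]
    refine Finset.sum_congr rfl fun i _ => ?_
    rw [Finset.sum_div]
    refine Finset.sum_congr rfl fun j _ => ?_
    rw [map_apply]
    ring
  rw [h2]
  positivity

variable {V : Type*} [AddCommGroup V]

/-- Real positive definite functions on an additive group. -/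
structure IsPosDefFun (φ : V → ℝ) : Prop where
  even : ∀ x, φ (-x) = φ x
  nonneg : ∀ (n : ℕ) (x : Fin n → V) (c : Fin n → ℝ), 0 ≤ ∑ i, ∑ j, c i * c j * φ (x i - x j)

/-- Real conditionally negative definite functions on an additive group, vanishing at zero. -/
structure IsCondNegDef (ψ : V → ℝ) : Prop where
  even : ∀ x, ψ (-x) = ψ x
  zero : ψ 0 = 0
  nonpos : ∀ (n : ℕ) (x : Fin n → V) (c : Fin n → ℝ), ∑ i, c i = 0 →
    ∑ i, ∑ j, c i * c j * ψ (x i - x j) ≤ 0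

theorem IsPosDefFun.mul {φ χ : V → ℝ} (hφ : IsPosDefFun φ) (hχ : IsPosDefFun χ) :
    IsPosDefFun fun x => φ x * χ x := by
  refine ⟨fun x => by rw [hφ.even, hχ.even], fun n x c => ?_⟩
  have hs : ∀ {φ : V → ℝ}, IsPosDefFun φ → ∀ i j, φ (x i - x j) = φ (x j - x i) :=
    fun {φ} h i j => by rw [← h.even, neg_sub]
  have h1 := (posSemidef_iff_sum_nonneg (M := Matrix.of fun i j => φ (x i - x j))
    (fun i j => hs hφ i j)).2 (hφ.nonneg n x)
  have h2 := (posSemidef_iff_sum_nonneg (M := Matrix.of fun i j => χ (x i - x j))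
    (fun i j => hs hχ i j)).2 (hχ.nonneg n x)
  have h3 := (posSemidef_iff_sum_nonneg
    (M := (Matrix.of fun i j => φ (x i - x j)) ⊙ (Matrix.of fun i j => χ (x i - x j)))
    (fun i j => by simp [hs hφ i j, hs hχ i j])).1 (h1.hadamard h2) c
  simpa using h3

/-- Test with the two points `x, 0` and the weights `(1, ±1)`. -/
theorem IsPosDefFun.abs_le {φ : V → ℝ} (hφ : IsPosDefFun φ) (x : V) : |φ x| ≤ φ 0 := by
  have h1 := hφ.nonneg 2 ![x, 0] ![1, 1]
  have h2 := hφ.nonneg 2 ![x, 0] ![1, -1]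
  simp [Fin.sum_univ_two, hφ.even] at h1 h2
  rw [_root_.abs_le]
  constructor <;> linarith

theorem sum_mul_cos_sub {n : ℕ} (c u : Fin n → ℝ) :
    ∑ i, ∑ j, c i * c j * Real.cos (u i - u j) =
      (∑ i, c i * Real.cos (u i)) ^ 2 + (∑ i, c i * Real.sin (u i)) ^ 2 := by
  rw [sq, sq, Finset.sum_mul_sum, Finset.sum_mul_sum, ← Finset.sum_add_distrib]
  refine Finset.sum_congr rfl fun i _ => ?_
  rw [← Finset.sum_add_distrib]
  refine Finset.sum_congr rfl fun j _ => ?_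
  rw [Real.cos_sub]
  ring

theorem isPosDefFun_cos (a : V →+ ℝ) : IsPosDefFun fun x => Real.cos (a x) := by
  refine ⟨fun x => by rw [map_neg, Real.cos_neg], fun n x c => ?_⟩
  simp only [map_sub, sum_mul_cos_sub]
  positivity

theorem IsPosDefFun.isCondNegDef {φ : V → ℝ} (hφ : IsPosDefFun φ) :
    IsCondNegDef fun x => φ 0 - φ x := by
  refine ⟨fun x => by rw [hφ.even], sub_self _, fun n x c hc => ?_⟩
  have h1 : ∑ i, ∑ j, c i * c j * (φ 0 - φ (x i - x j)) =
      (∑ i, c i) * (∑ j, c j) * φ 0 - ∑ i, ∑ j, c i * c j * φ (x i - x j) := by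
    rw [Finset.sum_mul_sum, Finset.sum_mul, ← Finset.sum_sub_distrib]
    refine Finset.sum_congr rfl fun i _ => ?_
    rw [Finset.sum_mul, ← Finset.sum_sub_distrib]
    exact Finset.sum_congr rfl fun j _ => by ring
  rw [h1, hc]
  linarith [hφ.nonneg n x c]

theorem IsCondNegDef.const_mul {ψ : V → ℝ} (hψ : IsCondNegDef ψ) {t : ℝ} (ht : 0 ≤ t) :
    IsCondNegDef fun x => t * ψ x := by
  refine ⟨fun x => by rw [hψ.even], by rw [hψ.zero, mul_zero], fun n x c hc => ?_⟩
  have : ∑ i, ∑ j, c i * c j * (t * ψ (x i - x j)) =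
      t * ∑ i, ∑ j, c i * c j * ψ (x i - x j) := by
    simp only [Finset.mul_sum]
    exact Finset.sum_congr rfl fun i _ => Finset.sum_congr rfl fun j _ => by ring
  rw [this]
  exact mul_nonpos_of_nonneg_of_nonpos ht (hψ.nonpos n x c hc)

theorem IsCondNegDef.sum {ι : Type*} (s : Finset ι) {ψ : ι → V → ℝ}
    (hψ : ∀ k ∈ s, IsCondNegDef (ψ k)) : IsCondNegDef fun x => ∑ k ∈ s, ψ k x := by
  refine ⟨fun x => Finset.sum_congr rfl fun k hk => (hψ k hk).even x,
    Finset.sum_eq_zero fun k hk => (hψ k hk).zero, fun n x c hc => ?_⟩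
  have : ∑ i, ∑ j, c i * c j * ∑ k ∈ s, ψ k (x i - x j) =
      ∑ k ∈ s, ∑ i, ∑ j, c i * c j * ψ k (x i - x j) := by
    rw [Finset.sum_comm (s := s)]
    refine Finset.sum_congr rfl fun i _ => ?_
    rw [Finset.sum_comm (s := s)]
    exact Finset.sum_congr rfl fun j _ => Finset.mul_sum _ _ _
  rw [this]
  exact Finset.sum_nonpos fun k hk => (hψ k hk).nonpos n x c hc

theorem IsCondNegDef.integral {α : Type*} [MeasurableSpace α] {μ : Measure α} {ψ : α → V → ℝ}
    (hψ : ∀ᵐ t ∂μ, IsCondNegDef (ψ t)) (hint : ∀ x, Integrable (fun t => ψ t x) μ) :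
    IsCondNegDef fun x => ∫ t, ψ t x ∂μ := by
  refine ⟨fun x => integral_congr_ae ?_, integral_eq_zero_of_ae ?_, fun n x c hc => ?_⟩
  · filter_upwards [hψ] with t ht using ht.even x
  · filter_upwards [hψ] with t ht using ht.zero
  have : ∑ i, ∑ j, c i * c j * ∫ t, ψ t (x i - x j) ∂μ =
      ∫ t, ∑ i, ∑ j, c i * c j * ψ t (x i - x j) ∂μ := by
    rw [integral_finsetSum _ fun i _ =>
      integrable_finsetSum _ fun j _ => (hint (x i - x j)).const_mul (c i * c j)]
    refine Finset.sum_congr rfl fun i _ => ?_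
    rw [integral_finsetSum _ fun j _ => (hint _).const_mul _]
    exact Finset.sum_congr rfl fun j _ => (integral_const_mul _ _).symm
  rw [this]
  refine integral_nonpos_of_ae ?_
  filter_upwards [hψ] with t ht using ht.nonpos n x c hc

/-- Schoenberg's theorem. -/
theorem IsCondNegDef.exp_neg {ψ : V → ℝ} (hψ : IsCondNegDef ψ) :
    IsPosDefFun fun x => Real.exp (-ψ x) := by
  refine ⟨fun x => by rw [hψ.even], fun n x c => ?_⟩
  -- `exp(-ψ(x_i - x_j))` is `exp(M i j)` times `exp(-ψ(x_i)) exp(-ψ(x_j))`, and these last factors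
  -- can be absorbed into the weights.
  set M : Matrix (Fin n) (Fin n) ℝ := Matrix.of fun i j => ψ (x i) + ψ (x j) - ψ (x i - x j) with hM
  have hMsymm : ∀ i j, M i j = M j i := fun i j => by
    simp only [hM, Matrix.of_apply]
    rw [← hψ.even (x j - x i), neg_sub]
    ring
  have hpsd : M.PosSemidef := by
    refine (posSemidef_iff_sum_nonneg hMsymm).2 fun b => ?_
    set C := ∑ i, b i with hC
    -- Adjoining the point `0` with weight `-C` makes the total weight zero; the cross terms then
    -- produce `ψ(x_i) + ψ(x_j)`.
    have h1 := hψ.nonpos (n + 1) (Fin.cons 0 x) (Fin.cons (-C) b) (by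
      simp [Fin.sum_univ_succ, ← hC])
    simp only [Fin.sum_univ_succ, Fin.cons_zero, Fin.cons_succ, sub_zero, hψ.zero, mul_zero,
      zero_add, zero_sub, hψ.even, Finset.sum_add_distrib] at h1
    have h2 : ∑ i, ∑ j, b i * b j * M i j =
        2 * (C * ∑ i, b i * ψ (x i)) - ∑ i, ∑ j, b i * b j * ψ (x i - x j) := by
      have e1 : ∑ i, ∑ j, b i * b j * ψ (x i) = C * ∑ i, b i * ψ (x i) := by
        rw [hC, Finset.sum_mul_sum, Finset.sum_comm]
        exact Finset.sum_congr rfl fun i _ => Finset.sum_congr rfl fun j _ => by ring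
      have e2 : ∑ i, ∑ j, b i * b j * ψ (x j) = C * ∑ i, b i * ψ (x i) := by
        rw [hC, Finset.sum_mul_sum]
        exact Finset.sum_congr rfl fun i _ => Finset.sum_congr rfl fun j _ => by ring
      simp only [hM, Matrix.of_apply, mul_sub, mul_add, Finset.sum_sub_distrib,
        Finset.sum_add_distrib, e1, e2]
      ring
    have e3 : ∑ j, -C * b j * ψ (x j) = -(C * ∑ i, b i * ψ (x i)) := by
      rw [← neg_mul, Finset.mul_sum]
      exact Finset.sum_congr rfl fun i _ => by ring
    have e4 : ∑ j, b j * -C * ψ (x j) = -(C * ∑ i, b i * ψ (x i)) := by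
      rw [← neg_mul, Finset.mul_sum]
      exact Finset.sum_congr rfl fun i _ => by ring
    rw [e3, e4] at h1
    rw [h2]
    linarith
  refine (sum_mul_exp_nonneg hpsd fun i => c i * Real.exp (-ψ (x i))).trans (le_of_eq ?_)
  refine Finset.sum_congr rfl fun i _ => Finset.sum_congr rfl fun j _ => ?_
  have : Real.exp (-ψ (x i - x j)) =
      Real.exp (-ψ (x i)) * Real.exp (-ψ (x j)) * Real.exp (M i j) := by
    rw [← Real.exp_add, ← Real.exp_add]
    congr 1
    simp only [hM, Matrix.of_apply]
    ring
  rw [this]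
  ring

/-- Near `0` the integrand is `O(t^{p-1-γ})`, at infinity `O(t^{-1-γ})`. -/
theorem integrableOn_mul_rpow_neg {h : ℝ → ℝ} (hc : Continuous h) {C p γ : ℝ} (hγ : 0 < γ)
    (hγp : γ < p) (h0 : ∀ t, 0 < t → |h t| ≤ C) (h1 : ∀ t, 0 < t → |h t| ≤ C * t ^ p) :
    IntegrableOn (fun t => h t * t ^ (-1 - γ)) (Set.Ioi 0) := by
  have hm : ∀ s : Set ℝ, MeasurableSet s →
      AEStronglyMeasurable (fun t => h t * t ^ (-1 - γ)) (volume.restrict s) := fun s _ =>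
    (hc.measurable.mul (by fun_prop)).aestronglyMeasurable
  rw [← Set.Ioc_union_Ioi_eq_Ioi zero_le_one]
  refine IntegrableOn.union ?_ ?_
  · have hi : IntegrableOn (fun t : ℝ => C * t ^ (p - 1 - γ)) (Set.Ioc 0 1) := by
      refine Integrable.const_mul ?_ C
      have := intervalIntegral.intervalIntegrable_rpow' (a := 0) (b := 1) (r := p - 1 - γ)
        (by linarith)
      rwa [intervalIntegrable_iff_integrableOn_Ioc_of_le zero_le_one] at this
    refine Integrable.mono' hi (hm _ measurableSet_Ioc) ?_
    filter_upwards [ae_restrict_mem measurableSet_Ioc] with t ht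
    rw [norm_mul, Real.norm_eq_abs, Real.norm_eq_abs, abs_of_pos (Real.rpow_pos_of_pos ht.1 _)]
    calc |h t| * t ^ (-1 - γ) ≤ C * t ^ p * t ^ (-1 - γ) := by
          gcongr
          · exact (Real.rpow_pos_of_pos ht.1 _).le
          · exact h1 t ht.1
      _ = C * t ^ (p - 1 - γ) := by
          rw [mul_assoc, ← Real.rpow_add ht.1]
          ring_nf
  · have hi : IntegrableOn (fun t : ℝ => C * t ^ (-1 - γ)) (Set.Ioi 1) :=
      (integrableOn_Ioi_rpow_of_lt (by linarith) zero_lt_one).const_mul C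
    refine Integrable.mono' hi (hm _ measurableSet_Ioi) ?_
    filter_upwards [ae_restrict_mem measurableSet_Ioi] with t ht
    have ht0 : 0 < t := zero_lt_one.trans ht
    rw [norm_mul, Real.norm_eq_abs, Real.norm_eq_abs, abs_of_pos (Real.rpow_pos_of_pos ht0 _)]
    exact mul_le_mul_of_nonneg_right (h0 t ht0) (Real.rpow_pos_of_pos ht0 _).le

/-- Substituting `t ↦ t/b` pulls out `b^γ`, and the integral that remains is positive. Powers
thereby become mixtures of `h(b t)`, used with `h = 1 - cos` and `h = 1 - e^{-|t|}`. -/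
theorem exists_integral_eq_const_mul_rpow {h : ℝ → ℝ} (hc : Continuous h) {C p γ : ℝ} (hγ : 0 < γ)
    (hγp : γ < p) (hh : h 0 = 0) (hnn : ∀ t, 0 < t → 0 ≤ h t) (hpos : ∀ t, 0 < t → t < 1 → 0 < h t)
    (h0 : ∀ t, 0 < t → |h t| ≤ C) (h1 : ∀ t, 0 < t → |h t| ≤ C * t ^ p) :
    ∃ κ : ℝ, 0 < κ ∧ ∀ b, 0 ≤ b →
      IntegrableOn (fun t => h (b * t) * t ^ (-1 - γ)) (Set.Ioi 0) ∧
      b ^ γ = κ * ∫ t in Set.Ioi 0, h (b * t) * t ^ (-1 - γ) := by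
  set J := ∫ t in Set.Ioi 0, h t * t ^ (-1 - γ) with hJ
  have hint := integrableOn_mul_rpow_neg hc hγ hγp h0 h1
  have hJ0 : 0 < J := by
    rw [hJ, setIntegral_pos_iff_support_of_nonneg_ae _ hint]
    · refine lt_of_lt_of_le ?_ (measure_mono (s := Set.Ioo (0 : ℝ) 1) fun t ht => ⟨?_, ht.1⟩)
      · simp
      · exact (mul_pos (hpos t ht.1 ht.2) (Real.rpow_pos_of_pos ht.1 _)).ne'
    · filter_upwards [ae_restrict_mem measurableSet_Ioi] with t ht
      exact mul_nonneg (hnn t ht) (Real.rpow_pos_of_pos ht _).le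
  refine ⟨J⁻¹, inv_pos.2 hJ0, fun b hb => ?_⟩
  rcases hb.eq_or_lt with rfl | hb
  · simp [hh, hγ.ne']
  have hfun : Set.EqOn (fun t => h (b * t) * t ^ (-1 - γ))
      (fun t => b ^ (1 + γ) * (h (b * t) * (b * t) ^ (-1 - γ))) (Set.Ioi 0) := fun t ht => by
    simp only
    rw [Real.mul_rpow hb.le (le_of_lt ht), mul_left_comm (h (b * t)), ← mul_assoc (b ^ (1 + γ)),
      ← Real.rpow_add hb]
    simp
  constructor
  · rw [integrableOn_congr_fun hfun measurableSet_Ioi]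
    refine Integrable.const_mul ?_ _
    have := (integrableOn_Ioi_comp_mul_left_iff (fun t => h t * t ^ (-1 - γ)) 0 hb).2
      (by rwa [mul_zero])
    exact this
  · rw [setIntegral_congr_fun measurableSet_Ioi hfun, integral_const_mul,
      integral_comp_mul_left_Ioi (fun t => h t * t ^ (-1 - γ)) 0 hb, mul_zero, ← hJ, smul_eq_mul,
      Real.rpow_add hb, Real.rpow_one]
    field_simp

/-- A positive mixture of the functions `1 - cos(t a(x))`. Since `1 - cos t` is quadratic at `0`,
convergence requires `γ < 2`. -/
theorem isCondNegDef_abs_rpow (a : V →+ ℝ) {γ : ℝ} (hγ : 0 < γ) (hγ2 : γ < 2) :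
    IsCondNegDef fun x => |a x| ^ γ := by
  obtain ⟨κ, hκ, h⟩ := exists_integral_eq_const_mul_rpow (h := fun t => 1 - Real.cos t) (C := 2)
    (p := 2) (by fun_prop) hγ hγ2 (by simp) (fun t _ => by linarith [Real.cos_le_one t])
    (fun t ht ht1 => by
      have h2 : Real.cos t < Real.cos 0 := Real.cos_lt_cos_of_nonneg_of_le_pi le_rfl
        (by linarith [Real.pi_gt_three]) ht
      rw [Real.cos_zero] at h2
      linarith)
    (fun t _ => by
      rw [abs_le]
      constructor <;> linarith [Real.cos_le_one t, Real.neg_one_le_cos t])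
    (fun t _ => by
      rw [abs_of_nonneg (by linarith [Real.cos_le_one t]), Real.rpow_two]
      nlinarith [Real.one_sub_sq_div_two_le_cos (x := t)])
  have hcos : ∀ x t, Real.cos (|a x| * t) = Real.cos (a x * t) := fun x t => by
    rcases abs_cases (a x) with ⟨h, _⟩ | ⟨h, _⟩ <;> rw [h]
    rw [neg_mul, Real.cos_neg]
  have heq : (fun x => |a x| ^ γ) =
      fun x => κ * ∫ t in Set.Ioi 0, (1 - Real.cos (a x * t)) * t ^ (-1 - γ) := by
    ext x
    rw [(h _ (abs_nonneg (a x))).2]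
    simp only [hcos]
  rw [heq]
  refine IsCondNegDef.const_mul (IsCondNegDef.integral ?_ fun x => ?_) hκ.le
  · filter_upwards [ae_restrict_mem measurableSet_Ioi] with t ht
    have h1 := (isPosDefFun_cos ((AddMonoidHom.mulRight t).comp a)).isCondNegDef.const_mul
      (Real.rpow_pos_of_pos ht (-1 - γ)).le
    simpa [mul_comm] using h1
  · have := (h _ (abs_nonneg (a x))).1
    simp only [hcos] at this
    exact this

theorem IsCondNegDef.nonneg {ψ : V → ℝ} (hψ : IsCondNegDef ψ) (x : V) : 0 ≤ ψ x := by
  have := hψ.nonpos 2 ![x, 0] ![1, -1] (by simp [Fin.sum_univ_two])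
  simp [Fin.sum_univ_two, hψ.even, hψ.zero] at this
  linarith

/-- A positive mixture of `1 - e^{-tψ}`, each conditionally negative definite by Schoenberg's
theorem; convergence at `0` requires `γ < 1`, and `γ = 1` is trivial. -/
theorem IsCondNegDef.rpow {ψ : V → ℝ} (hψ : IsCondNegDef ψ) {γ : ℝ} (hγ : 0 < γ) (hγ1 : γ ≤ 1) :
    IsCondNegDef fun x => ψ x ^ γ := by
  rcases hγ1.eq_or_lt with rfl | hγ1
  · simpa using hψ
  obtain ⟨κ, hκ, h⟩ := exists_integral_eq_const_mul_rpow (h := fun t => 1 - Real.exp (-|t|)) (C := 1)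
    (p := 1) (by fun_prop) hγ hγ1 (by simp)
    (fun t _ => by linarith [Real.exp_le_one_iff.2 (neg_nonpos.2 (abs_nonneg t))])
    (fun t ht _ => by
      have : Real.exp (-|t|) < 1 := Real.exp_lt_one_iff.2 (by simpa using ht.ne')
      linarith)
    (fun t _ => by
      rw [abs_of_nonneg (by linarith [Real.exp_le_one_iff.2 (neg_nonpos.2 (abs_nonneg t))])]
      linarith [Real.exp_pos (-|t|)])
    (fun t ht => by
      rw [abs_of_nonneg (by linarith [Real.exp_le_one_iff.2 (neg_nonpos.2 (abs_nonneg t))]),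
        Real.rpow_one, abs_of_pos ht]
      linarith [Real.add_one_le_exp (-t)])
  have heq : (fun x => ψ x ^ γ) =
      fun x => κ * ∫ t in Set.Ioi 0, (1 - Real.exp (-|ψ x * t|)) * t ^ (-1 - γ) := by
    ext x
    rw [(h _ (hψ.nonneg x)).2]
  rw [heq]
  refine IsCondNegDef.const_mul (IsCondNegDef.integral ?_ fun x => (h _ (hψ.nonneg x)).1) hκ.le
  filter_upwards [ae_restrict_mem measurableSet_Ioi] with t ht
  have h1 := (hψ.const_mul (le_of_lt ht)).exp_neg.isCondNegDef.const_mul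
    (Real.rpow_pos_of_pos ht (-1 - γ)).le
  have h2 : ∀ x, |ψ x * t| = t * ψ x := fun x => by
    rw [abs_of_nonneg (mul_nonneg (hψ.nonneg x) (le_of_lt ht)), mul_comm]
  simp only [h2]
  simpa [hψ.zero, mul_comm] using h1

end PosDef

/-- The dyadic grouping is what makes this work: `2^l < 2j` keeps the inner exponents `2^l/j` below
`2`, and the outer exponent `1/2^l` is at most `1`. -/
theorem isCondNegDef_parabolicNorm (d : ℕ) : IsCondNegDef (parabolicNorm (d := d)) := by
  unfold parabolicNorm
  refine IsCondNegDef.sum _ fun l _ => IsCondNegDef.rpow (IsCondNegDef.sum _ fun i hi => ?_)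
    (by positivity) ?_
  · have hi' := (Finset.mem_filter.1 hi).2.1
    refine isCondNegDef_abs_rpow
      ((EuclideanSpace.proj i : E d →L[ℝ] ℝ) : E d →+ ℝ) (by positivity) ?_
    rw [div_lt_iff₀ (by positivity)]
    exact_mod_cast hi'
  · rw [div_le_one (by positivity)]
    exact one_le_pow₀ (by norm_num)

theorem isPosDefFun_exp_neg_parabolicNorm (d : ℕ) :
    IsPosDefFun fun x : E d => Real.exp (-parabolicNorm x) :=
  (isCondNegDef_parabolicNorm d).exp_neg

/-! ### Integrals of positive definite functions -/

section

variable {V : Type*} [NormedAddCommGroup V] [InnerProductSpace ℝ V] [MeasurableSpace V]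
  [BorelSpace V] [FiniteDimensional ℝ V]

/-- Take `N` independent samples of `γ` with unit weights. The diagonal contributes `N φ(0)` and the
rest `N(N-1) I`, so a negative `I` would win for large `N`. -/
theorem IsPosDefFun.integral_prod_nonneg {φ : V → ℝ} (hφ : IsPosDefFun φ) (hc : Continuous φ)
    (γ : Measure V) [IsProbabilityMeasure γ] :
    0 ≤ ∫ p : V × V, φ (p.1 - p.2) ∂(γ.prod γ) := by
  set I := ∫ p : V × V, φ (p.1 - p.2) ∂(γ.prod γ) with hI
  -- the average over independent samples
  have key : ∀ N : ℕ, 0 ≤ N * φ 0 + N * (N - 1) * I := by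
    intro N
    set P : Measure (Fin N → V) := Measure.pi fun _ => γ with hP
    have hint : ∀ i j : Fin N, Integrable (fun ω : Fin N → V => φ (ω i - ω j)) P := fun i j =>
      (integrable_const (φ 0)).mono'
        (hc.comp (by fun_prop : Continuous fun ω : Fin N → V => ω i - ω j)).aestronglyMeasurable
        (Filter.Eventually.of_forall fun ω => hφ.abs_le _)
    have hij : ∀ i j : Fin N, ∫ ω, φ (ω i - ω j) ∂P = if i = j then φ 0 else I := fun i j => by
      split_ifs with h
      · subst h
        simp
      · have hind := (ProbabilityTheory.iIndepFun_pi (μ := fun _ : Fin N => γ)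
          (X := fun _ => id) fun _ => aemeasurable_id).indepFun h
        have hmap := (ProbabilityTheory.indepFun_iff_map_prod_eq_prod_map_map
          (measurable_pi_apply i).aemeasurable (measurable_pi_apply j).aemeasurable).1 hind
        change P.map (fun ω => (ω i, ω j)) = (P.map fun ω => ω i).prod (P.map fun ω => ω j) at hmap
        rw [(measurePreserving_eval (fun _ : Fin N => γ) i).map_eq,
          (measurePreserving_eval (fun _ : Fin N => γ) j).map_eq] at hmap
        rw [hI, ← hmap, integral_map]
        · exact Measurable.aemeasurable (by fun_prop)
        · exact (hc.comp (by fun_prop : Continuous fun p : V × V => p.1 - p.2)).aestronglyMeasurable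
    have h1 : 0 ≤ ∫ ω, ∑ i : Fin N, ∑ j : Fin N, φ (ω i - ω j) ∂P := by
      refine integral_nonneg fun ω => ?_
      simpa using hφ.nonneg N ω fun _ => 1
    rw [integral_finsetSum _ fun i _ => integrable_finsetSum _ fun j _ => hint i j] at h1
    simp_rw [fun i : Fin N => integral_finsetSum Finset.univ fun j _ => hint i j, hij] at h1
    have h2 : ∀ i : Fin N, ∑ j, (if i = j then φ 0 else I) = φ 0 + (N - 1) * I := fun i => by
      have : ∀ j, (if i = j then φ 0 else I) = (if i = j then φ 0 - I else 0) + I := fun j => by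
        split_ifs <;> ring
      simp only [this, Finset.sum_add_distrib, Finset.sum_ite_eq, Finset.mem_univ, if_true,
        Finset.sum_const, Finset.card_univ, Fintype.card_fin, nsmul_eq_mul]
      ring
    simp only [h2, Finset.sum_const, Finset.card_univ, Fintype.card_fin, nsmul_eq_mul] at h1
    linarith
  by_contra! hneg
  obtain ⟨N, hN⟩ := exists_nat_gt (φ 0 / (-I))
  have h1 := key (N + 1)
  rw [div_lt_iff₀ (by linarith)] at hN
  push_cast at h1
  nlinarith [Nat.cast_nonneg (α := ℝ) N]

theorem integrable_exp_neg_mul_sq_norm {b : ℝ} (hb : 0 < b) :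
    Integrable fun v : V => Real.exp (-b * ‖v‖ ^ 2) := by
  have := (GaussianFourier.integrable_cexp_neg_mul_sq_norm_add (V := V) (b := b) (by simpa using hb)
    0 0).norm
  refine this.congr (Filter.Eventually.of_forall fun v => ?_)
  simp only [zero_mul, add_zero, Complex.norm_exp]
  congr 1
  norm_cast

theorem integral_exp_neg_mul_sq_norm_pos {b : ℝ} (hb : 0 < b) :
    0 < ∫ v : V, Real.exp (-b * ‖v‖ ^ 2) := by
  rw [GaussianFourier.integral_rexp_neg_mul_sq_norm hb]
  positivity

/-- The difference of two independent Gaussian variables with density proportional to `e^{-b‖v‖²}`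
has density proportional to `e^{-(b/2)‖u‖²}`. -/
theorem IsPosDefFun.integral_mul_gaussian_nonneg {φ : V → ℝ} (hφ : IsPosDefFun φ)
    (hc : Continuous φ) {b : ℝ} (hb : 0 < b) :
    0 ≤ ∫ u, φ u * Real.exp (-(b / 2) * ‖u‖ ^ 2) := by
  set g : V → ℝ := fun v => Real.exp (-b * ‖v‖ ^ 2) with hg
  have hgi : Integrable g := integrable_exp_neg_mul_sq_norm hb
  have hgc : Continuous g := by
    simp only [hg]
    fun_prop
  set Z := ∫ v, g v with hZ
  have hZ0 : 0 < Z := integral_exp_neg_mul_sq_norm_pos hb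
  set ρ : V → ℝ≥0∞ := fun v => ENNReal.ofReal (g v / Z) with hρ
  have hg0 : ∀ v, 0 ≤ g v / Z := fun v => div_nonneg (Real.exp_pos _).le hZ0.le
  have hρm : Measurable ρ := (hgc.measurable.div_const Z).ennreal_ofReal
  have hprob : IsProbabilityMeasure (volume.withDensity ρ) := ⟨by
    rw [withDensity_apply _ MeasurableSet.univ, Measure.restrict_univ,
      ← ofReal_integral_eq_lintegral_ofReal (hgi.div_const Z) (Filter.Eventually.of_forall hg0),
      integral_div, ← hZ, div_self hZ0.ne', ENNReal.ofReal_one]⟩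
  have h1 := hφ.integral_prod_nonneg hc (volume.withDensity ρ)
  have hφb : ∀ p : V × V, ‖φ (p.1 - p.2)‖ ≤ φ 0 := fun p => hφ.abs_le _
  have hφc : Continuous fun p : V × V => φ (p.1 - p.2) := by fun_prop
  have hgg : Integrable (fun p : V × V => g p.1 * g p.2) := hgi.mul_prod hgi
  have hφgg : Integrable (fun p : V × V => φ (p.1 - p.2) * (g p.1 * g p.2)) :=
    hgg.bdd_mul hφc.aestronglyMeasurable (Filter.Eventually.of_forall hφb)
  rw [prod_withDensity hρm hρm, integral_withDensity_eq_integral_toReal_smul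
    (by fun_prop) (by simp [hρ, ENNReal.mul_lt_top])] at h1
  have h2 : ∫ p : V × V, φ (p.1 - p.2) * (g p.1 * g p.2) =
      Z ^ 2 * ∫ p : V × V, (ρ p.1 * ρ p.2).toReal • φ (p.1 - p.2) ∂(volume.prod volume) := by
    rw [← integral_const_mul]
    refine integral_congr_ae (Filter.Eventually.of_forall fun p => ?_)
    simp only [hρ, ENNReal.toReal_mul, ENNReal.toReal_ofReal (hg0 _), smul_eq_mul]
    field_simp
  have h3 : 0 ≤ ∫ p : V × V, φ (p.1 - p.2) * (g p.1 * g p.2) := h2 ▸ by positivity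
  -- change variables `u = x - y`
  have hFc : Continuous fun p : V × V => φ p.1 * (g (p.1 + p.2) * g p.2) := by fun_prop
  have hmp := measurePreserving_sub_prod (volume : Measure V) (volume : Measure V)
  rw [← Measure.volume_eq_prod] at hmp
  have h4 : ∫ p : V × V, φ (p.1 - p.2) * (g p.1 * g p.2) =
      ∫ p : V × V, φ p.1 * (g (p.1 + p.2) * g p.2) := by
    have h := integral_map (μ := volume) hmp.measurable.aemeasurable
      (f := fun p : V × V => φ p.1 * (g (p.1 + p.2) * g p.2)) hFc.aestronglyMeasurable
    simpa only [hmp.map_eq, sub_add_cancel] using h.symm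
  have hFi : Integrable fun p : V × V => φ p.1 * (g (p.1 + p.2) * g p.2) := by
    refine (hmp.integrable_comp hFc.aestronglyMeasurable).1 (hφgg.congr ?_)
    refine Filter.Eventually.of_forall fun p => ?_
    simp only [Function.comp, sub_add_cancel]
  -- complete the square
  have hsq : ∀ u y : V, g (u + y) * g y =
      Real.exp (-(b / 2) * ‖u‖ ^ 2) * Real.exp (-(2 * b) * ‖y + (1 / 2 : ℝ) • u‖ ^ 2) := by
    intro u y
    simp only [hg, ← Real.exp_add]
    congr 1
    rw [norm_add_sq_real, norm_add_sq_real, inner_smul_right, norm_smul, real_inner_comm]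
    norm_num
    ring
  have h5 : ∀ u : V, ∫ y, φ u * (g (u + y) * g y) =
      φ u * Real.exp (-(b / 2) * ‖u‖ ^ 2) * ∫ y : V, Real.exp (-(2 * b) * ‖y‖ ^ 2) := by
    intro u
    simp_rw [hsq, ← mul_assoc]
    rw [integral_const_mul,
      integral_add_right_eq_self (fun y : V => Real.exp (-(2 * b) * ‖y‖ ^ 2)) ((1 / 2 : ℝ) • u)]
  rw [h4, Measure.volume_eq_prod, integral_prod _ hFi] at h3
  simp only [h5, integral_mul_const] at h3
  exact nonneg_of_mul_nonneg_left h3 (integral_exp_neg_mul_sq_norm_pos (by positivity))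

theorem IsPosDefFun.integral_nonneg {φ : V → ℝ} (hφ : IsPosDefFun φ) (hc : Continuous φ)
    (hi : Integrable φ) : 0 ≤ ∫ u, φ u := by
  have hlim : Filter.Tendsto (fun n : ℕ => ∫ u, φ u * Real.exp (-(1 / ((n : ℝ) + 1) / 2) * ‖u‖ ^ 2))
      Filter.atTop (nhds (∫ u, φ u)) := by
    refine tendsto_integral_of_dominated_convergence (fun u => ‖φ u‖) (fun n => ?_) hi.norm
      (fun n => Filter.Eventually.of_forall fun u => ?_) (Filter.Eventually.of_forall fun u => ?_)
    · exact Continuous.aestronglyMeasurable (by fun_prop)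
    · rw [norm_mul]
      refine mul_le_of_le_one_right (norm_nonneg _) ?_
      rw [Real.norm_of_nonneg (Real.exp_pos _).le, Real.exp_le_one_iff, neg_mul, neg_nonpos]
      positivity
    · have h := (tendsto_one_div_add_atTop_nhds_zero_nat (𝕜 := ℝ))
      have h2 := (Real.continuous_exp.tendsto _).comp (((h.div_const 2).neg).mul_const (‖u‖ ^ 2))
      simpa using (h2.const_mul (φ u))
  exact ge_of_tendsto' hlim fun n => hφ.integral_mul_gaussian_nonneg hc (by positivity)

end

/-! ### Inverse Fourier transforms of positive definite functions -/

section

variable {V : Type*} [NormedAddCommGroup V] [InnerProductSpace ℝ V] [MeasurableSpace V]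
  [BorelSpace V] [FiniteDimensional ℝ V]

theorem IsPosDefFun.fourierInv_ofReal {φ : V → ℝ} (hφ : IsPosDefFun φ) (hi : Integrable φ)
    (x : V) : 𝓕⁻ (fun ξ => (φ ξ : ℂ)) x =
      ((∫ ξ, φ ξ * Real.cos (2 * Real.pi * inner ℝ ξ x) : ℝ) : ℂ) := by
  have hcos : Integrable fun ξ => φ ξ * Real.cos (2 * Real.pi * inner ℝ ξ x) :=
    hi.mul_bdd (c := 1) (Continuous.aestronglyMeasurable (by fun_prop))
      (Filter.Eventually.of_forall fun ξ => Real.abs_cos_le_one _)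
  have hsin : Integrable fun ξ => φ ξ * Real.sin (2 * Real.pi * inner ℝ ξ x) :=
    hi.mul_bdd (c := 1) (Continuous.aestronglyMeasurable (by fun_prop))
      (Filter.Eventually.of_forall fun ξ => Real.abs_sin_le_one _)
  have hodd : ∫ ξ, φ ξ * Real.sin (2 * Real.pi * inner ℝ ξ x) = 0 := by
    have h := integral_neg_eq_self (fun ξ => φ ξ * Real.sin (2 * Real.pi * inner ℝ ξ x)) volume
    simp only [hφ.even, inner_neg_left, mul_neg, Real.sin_neg, integral_neg] at h
    linarith
  have hsplit : ∀ ξ, Complex.exp ((2 * Real.pi * inner ℝ ξ x : ℝ) * Complex.I) • (φ ξ : ℂ) =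
      ((φ ξ * Real.cos (2 * Real.pi * inner ℝ ξ x) : ℝ) : ℂ) +
        ((φ ξ * Real.sin (2 * Real.pi * inner ℝ ξ x) : ℝ) : ℂ) * Complex.I := by
    intro ξ
    rw [Complex.exp_mul_I, smul_eq_mul]
    push_cast
    ring
  rw [Real.fourierInv_eq']
  simp_rw [hsplit]
  rw [integral_add (by exact hcos.ofReal) (by exact hsin.ofReal.mul_const _), integral_mul_const,
    integral_complex_ofReal, integral_complex_ofReal, hodd]
  simp

/-- The value at `x` is the integral of `φ` times a cosine, a product of positive definite
functions. -/
theorem IsPosDefFun.fourierInv_re_nonneg {φ : V → ℝ} (hφ : IsPosDefFun φ) (hc : Continuous φ)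
    (hi : Integrable φ) (x : V) : 0 ≤ (𝓕⁻ (fun ξ => (φ ξ : ℂ)) x).re := by
  rw [hφ.fourierInv_ofReal hi, Complex.ofReal_re]
  have hcos := isPosDefFun_cos (V := V)
    ⟨⟨fun ξ => 2 * Real.pi * inner ℝ ξ x, by simp⟩, fun ξ η => by simp [inner_add_left, mul_add]⟩
  refine (hφ.mul hcos).integral_nonneg (hc.mul (Real.continuous_cos.comp ?_))
    (hi.mul_bdd (c := 1) (Continuous.aestronglyMeasurable (Real.continuous_cos.comp ?_))
      (Filter.Eventually.of_forall fun ξ => Real.abs_cos_le_one _))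
  all_goals
    change Continuous fun ξ : V => 2 * Real.pi * inner ℝ ξ x
    fun_prop

theorem continuous_fourierInv {f : V → ℂ} (hf : Integrable f) : Continuous (𝓕⁻ f) := by
  have : 𝓕⁻ f = fun w => 𝓕 f (-w) := funext fun w => Real.fourierInv_eq_fourier_neg f w
  rw [this]
  exact (VectorFourier.fourierIntegral_continuous Real.continuous_fourierChar
    (by exact continuous_inner) hf).comp continuous_neg

theorem norm_fourierInv_gaussian {b : ℝ} (hb : 0 < b) (w : V) :
    ‖𝓕⁻ (fun v : V => Complex.exp (-(b : ℂ) * (‖v‖ : ℂ) ^ 2)) w‖ =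
      (Real.pi / b) ^ ((Module.finrank ℝ V : ℝ) / 2) * Real.exp (-(Real.pi ^ 2 / b) * ‖w‖ ^ 2) := by
  rw [Real.fourierInv_eq_fourier_neg, fourier_gaussian_innerProductSpace (by simpa using hb),
    norm_mul, Complex.norm_exp, norm_neg]
  congr 1
  · rw [← Complex.ofReal_div, Complex.norm_cpow_eq_rpow_re_of_pos (by positivity)]
    simp
  · congr 1
    norm_cast
    ring

theorem integral_norm_fourierInv_gaussian {b : ℝ} (hb : 0 < b) :
    ∫ w : V, ‖𝓕⁻ (fun v : V => Complex.exp (-(b : ℂ) * (‖v‖ : ℂ) ^ 2)) w‖ = 1 := by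
  simp_rw [norm_fourierInv_gaussian hb]
  rw [integral_const_mul, GaussianFourier.integral_rexp_neg_mul_sq_norm (by positivity),
    ← Real.mul_rpow (by positivity) (by positivity)]
  have : Real.pi / b * (Real.pi / (Real.pi ^ 2 / b)) = 1 := by
    field_simp
  rw [this, Real.one_rpow]

/-- Move the transform onto the Gaussian: its inverse transform has `L¹` norm `1`, and `|φ| ≤ φ(0)`.
-/
theorem IsPosDefFun.integral_fourierInv_mul_gaussian_le {φ : V → ℝ} (hφ : IsPosDefFun φ)
    (hi : Integrable φ) {b : ℝ} (hb : 0 < b) :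
    ∫ x, (𝓕⁻ (fun ξ => (φ ξ : ℂ)) x).re * Real.exp (-b * ‖x‖ ^ 2) ≤ φ 0 := by
  have hg : Integrable fun v : V => Complex.exp (-(b : ℂ) * (‖v‖ : ℂ) ^ 2) := by
    refine (integrable_exp_neg_mul_sq_norm (V := V) hb).ofReal.congr
      (Filter.Eventually.of_forall fun v => ?_)
    simp
  have hgF : Integrable fun w : V =>
      ‖𝓕⁻ (fun v : V => Complex.exp (-(b : ℂ) * (‖v‖ : ℂ) ^ 2)) w‖ := by
    by_contra h
    have := integral_undef h
    rw [integral_norm_fourierInv_gaussian hb] at this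
    norm_num at this
  have h1 := integral_fourierInv_mul_eq (f := fun ξ => (φ ξ : ℂ)) hi.ofReal hg
  have h2 : ∫ x, 𝓕⁻ (fun ξ => (φ ξ : ℂ)) x * Complex.exp (-(b : ℂ) * (‖x‖ : ℂ) ^ 2) =
      ((∫ x, (𝓕⁻ (fun ξ => (φ ξ : ℂ)) x).re * Real.exp (-b * ‖x‖ ^ 2) : ℝ) : ℂ) := by
    rw [← integral_complex_ofReal]
    refine integral_congr_ae (Filter.Eventually.of_forall fun x => ?_)
    simp only [hφ.fourierInv_ofReal hi, Complex.ofReal_re]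
    push_cast
    rfl
  have h3 : ‖∫ x, (φ x : ℂ) * 𝓕⁻ (fun v : V => Complex.exp (-(b : ℂ) * (‖v‖ : ℂ) ^ 2)) x‖ ≤
      ∫ x : V, φ 0 * ‖𝓕⁻ (fun v : V => Complex.exp (-(b : ℂ) * (‖v‖ : ℂ) ^ 2)) x‖ := by
    refine norm_integral_le_of_norm_le (hgF.const_mul _) (Filter.Eventually.of_forall fun x => ?_)
    rw [norm_mul, Complex.norm_real]
    gcongr
    exact hφ.abs_le x
  rw [integral_const_mul, integral_norm_fourierInv_gaussian hb, mul_one] at h3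
  have h4 := h2.symm.trans h1
  rw [← h4, Complex.norm_real] at h3
  exact (le_abs_self _).trans h3

/-- The inverse transform is nonnegative and its Gaussian regularisations have integrals at most
`φ(0)`, so Fatou's lemma gives integrability without any decay estimate. -/
theorem IsPosDefFun.integrable_fourierInv {φ : V → ℝ} (hφ : IsPosDefFun φ) (hc : Continuous φ)
    (hi : Integrable φ) : Integrable (𝓕⁻ (fun ξ => (φ ξ : ℂ))) := by
  set P : V → ℝ := fun x => (𝓕⁻ (fun ξ => (φ ξ : ℂ)) x).re with hP
  have hFc : Continuous (𝓕⁻ (fun ξ => (φ ξ : ℂ))) := continuous_fourierInv hi.ofReal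
  have hPc : Continuous P := Complex.continuous_re.comp hFc
  have hP0 : ∀ x, 0 ≤ P x := hφ.fourierInv_re_nonneg hc hi
  have hPb : ∀ x, ‖P x‖ ≤ ∫ ξ, ‖φ ξ‖ := fun x => by
    rw [hP]
    simp only [hφ.fourierInv_ofReal hi, Complex.ofReal_re]
    refine norm_integral_le_of_norm_le hi.norm (Filter.Eventually.of_forall fun ξ => ?_)
    rw [norm_mul]
    exact mul_le_of_le_one_right (norm_nonneg _) (Real.abs_cos_le_one _)
  have hb0 : ∀ n : ℕ, 0 < 1 / ((n : ℝ) + 1) := fun n => by positivity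
  set G : ℕ → V → ℝ := fun n x => P x * Real.exp (-(1 / ((n : ℝ) + 1)) * ‖x‖ ^ 2) with hG
  have hGc : ∀ n, Continuous (G n) := fun n => by fun_prop
  have hG0 : ∀ n x, 0 ≤ G n x := fun n x => mul_nonneg (hP0 x) (Real.exp_pos _).le
  have hle : ∀ n, ∫⁻ x, ENNReal.ofReal (G n x) ≤ ENNReal.ofReal (φ 0) := fun n => by
    have hGi : Integrable (G n) := (integrable_exp_neg_mul_sq_norm (hb0 n)).bdd_mul
      hPc.aestronglyMeasurable (Filter.Eventually.of_forall hPb)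
    rw [← ofReal_integral_eq_lintegral_ofReal hGi (Filter.Eventually.of_forall (hG0 n))]
    exact ENNReal.ofReal_le_ofReal (hφ.integral_fourierInv_mul_gaussian_le hi (hb0 n))
  have hlim : ∀ x, Filter.Tendsto (fun n => ENNReal.ofReal (G n x)) Filter.atTop
      (nhds (ENNReal.ofReal (P x))) := fun x => by
    refine ENNReal.tendsto_ofReal ?_
    have h := (tendsto_one_div_add_atTop_nhds_zero_nat (𝕜 := ℝ)).neg.mul_const (‖x‖ ^ 2)
    simpa [hG] using ((Real.continuous_exp.tendsto _).comp h).const_mul (P x)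
  have hfin : ∫⁻ x, ENNReal.ofReal (P x) ≤ ENNReal.ofReal (φ 0) := by
    calc ∫⁻ x, ENNReal.ofReal (P x)
        = ∫⁻ x, Filter.liminf (fun n => ENNReal.ofReal (G n x)) Filter.atTop := by
          simp_rw [fun x => (hlim x).liminf_eq]
      _ ≤ Filter.liminf (fun n => ∫⁻ x, ENNReal.ofReal (G n x)) Filter.atTop :=
          lintegral_liminf_le fun n => (hGc n).measurable.ennreal_ofReal
      _ ≤ Filter.liminf (fun _ : ℕ => ENNReal.ofReal (φ 0)) Filter.atTop :=
          Filter.liminf_le_liminf (Filter.Eventually.of_forall hle)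
      _ = ENNReal.ofReal (φ 0) := Filter.liminf_const _
  have hPi : Integrable P := by
    refine ⟨hPc.aestronglyMeasurable, ?_⟩
    rw [hasFiniteIntegral_iff_ofReal (Filter.Eventually.of_forall hP0)]
    exact hfin.trans_lt ENNReal.ofReal_lt_top
  refine hPi.ofReal.congr (Filter.Eventually.of_forall fun x => ?_)
  simp only [hP, hφ.fourierInv_ofReal hi, Complex.ofReal_re]
  rfl

theorem IsPosDefFun.fourier_fourierInv_eq {φ : V → ℝ} (hφ : IsPosDefFun φ) (hc : Continuous φ)
    (hi : Integrable φ) : 𝓕 (𝓕⁻ (fun ξ => (φ ξ : ℂ))) = fun ξ => (φ ξ : ℂ) := by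
  refine Continuous.fourier_fourierInv_eq (Complex.continuous_ofReal.comp hc) hi.ofReal ?_
  refine (hφ.integrable_fourierInv hc hi).comp_neg.congr (Filter.Eventually.of_forall fun x => ?_)
  simp only [Real.fourierInv_eq_fourier_neg, neg_neg]

end

/-! ### The Poisson kernel as a finite measure -/

theorem continuous_parabolicNorm (d : ℕ) : Continuous (parabolicNorm (d := d)) := by
  unfold parabolicNorm
  refine continuous_finsetSum _ fun l _ => Continuous.rpow_const ?_ fun x => Or.inr (by positivity)
  refine continuous_finsetSum _ fun i _ => Continuous.rpow_const ?_ fun x => Or.inr (by positivity)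
  fun_prop

theorem abs_rpow_le_parabolicNorm {d : ℕ} (x : E d) (i : Fin d) :
    |x i| ^ (1 / ((i : ℝ) + 1)) ≤ parabolicNorm x := by
  have h1 := abs_le_blockNorm_pow x i ((mem_block_iff (Nat.le_add_left 1 i)).2 rfl)
  have h2 : blockNorm (Nat.clog 2 ((i : ℕ) + 1)) x ≤ parabolicNorm x := by
    rw [parabolicNorm_eq_sum_blockNorm]
    exact Finset.single_le_sum (f := fun l => blockNorm l x) (fun l _ => blockNorm_nonneg l x)
      (clog_succ_mem_range i)
  refine le_trans ?_ h2
  calc |x i| ^ (1 / ((i : ℝ) + 1))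
      ≤ (blockNorm (Nat.clog 2 ((i : ℕ) + 1)) x ^ ((i : ℕ) + 1)) ^ (1 / ((i : ℝ) + 1)) := by
        gcongr
    _ = blockNorm (Nat.clog 2 ((i : ℕ) + 1)) x := by
        rw [one_div]
        exact_mod_cast Real.pow_rpow_inv_natCast (blockNorm_nonneg _ x) (Nat.succ_ne_zero _)

theorem integrable_exp_neg_mul_abs_rpow {a p : ℝ} (ha : 0 < a) (hp : 0 < p) :
    Integrable fun t : ℝ => Real.exp (-a * |t| ^ p) := by
  by_contra h
  have h1 := integral_undef h
  rw [integral_comp_abs (f := fun t => Real.exp (-a * t ^ p)),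
    integral_exp_neg_mul_rpow hp ha] at h1
  have : 0 < Real.Gamma (1 / p + 1) := Real.Gamma_pos_of_pos (by positivity)
  have : 0 < 2 * (a ^ (-1 / p) * Real.Gamma (1 / p + 1)) := by positivity
  exact this.ne' h1

/-- As `ρ` dominates each `|x_j|^{1/j}`, it dominates their average, so `e^{-ρ}` is bounded by a
product of integrable functions of one variable. -/
theorem integrable_exp_neg_parabolicNorm (d : ℕ) :
    Integrable fun x : E d => Real.exp (-parabolicNorm x) := by
  rcases Nat.eq_zero_or_pos d with rfl | hd
  · exact (integrable_const (1 : ℝ)).mono'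
      (Real.continuous_exp.comp (continuous_parabolicNorm 0).neg).aestronglyMeasurable
      (Filter.Eventually.of_forall fun x => by
        rw [Real.norm_of_nonneg (Real.exp_pos _).le, Real.exp_le_one_iff]
        linarith [parabolicNorm_nonneg x])
  have hd' : (0 : ℝ) < d := by exact_mod_cast hd
  have h1 : Integrable (fun x : Fin d → ℝ =>
      ∏ i, Real.exp (-(1 / (d : ℝ)) * |x i| ^ (1 / ((i : ℝ) + 1)))) :=
    Integrable.fintype_prod (f := fun (i : Fin d) t =>
      Real.exp (-(1 / (d : ℝ)) * |t| ^ (1 / ((i : ℝ) + 1))))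
      fun i => integrable_exp_neg_mul_abs_rpow (by positivity) (by positivity)
  have h2 := (PiLp.volume_preserving_ofLp (Fin d)).integrable_comp_of_integrable h1
  refine h2.mono' (Real.continuous_exp.comp (continuous_parabolicNorm d).neg).aestronglyMeasurable
    (Filter.Eventually.of_forall fun x => ?_)
  rw [Real.norm_of_nonneg (Real.exp_pos _).le]
  simp only [Function.comp]
  rw [← Real.exp_sum, Real.exp_le_exp, ← Finset.mul_sum, neg_mul, neg_le_neg_iff,
    one_div_mul_eq_div, div_le_iff₀ hd']
  calc ∑ i : Fin d, |x i| ^ (1 / ((i : ℝ) + 1)) ≤ ∑ i : Fin d, parabolicNorm x :=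
        Finset.sum_le_sum fun i _ => abs_rpow_le_parabolicNorm x i
    _ = parabolicNorm x * d := by simp [mul_comm]

theorem continuous_exp_neg_parabolicNorm (d : ℕ) :
    Continuous fun x : E d => Real.exp (-parabolicNorm x) :=
  Real.continuous_exp.comp (continuous_parabolicNorm d).neg

theorem poissonKernel_nonneg (d : ℕ) (x : E d) : 0 ≤ poissonKernel d x :=
  (isPosDefFun_exp_neg_parabolicNorm d).fourierInv_re_nonneg (continuous_exp_neg_parabolicNorm d)
    (integrable_exp_neg_parabolicNorm d) x

theorem ofReal_poissonKernel (d : ℕ) :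
    (fun x : E d => (poissonKernel d x : ℂ)) =
      𝓕⁻ (fun ξ : E d => (Real.exp (-parabolicNorm ξ) : ℂ)) := by
  funext x
  rw [poissonKernel, (isPosDefFun_exp_neg_parabolicNorm d).fourierInv_ofReal
    (integrable_exp_neg_parabolicNorm d), Complex.ofReal_re]

theorem continuous_poissonKernel (d : ℕ) : Continuous (poissonKernel d) :=
  Complex.continuous_re.comp (continuous_fourierInv (integrable_exp_neg_parabolicNorm d).ofReal)

theorem integrable_poissonKernel (d : ℕ) : Integrable (poissonKernel d) :=
  ((isPosDefFun_exp_neg_parabolicNorm d).integrable_fourierInv (continuous_exp_neg_parabolicNorm d)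
    (integrable_exp_neg_parabolicNorm d)).re

theorem fourier_poissonKernel (d : ℕ) :
    𝓕 (fun x : E d => (poissonKernel d x : ℂ)) =
      fun ξ => (Real.exp (-parabolicNorm ξ) : ℂ) := by
  rw [ofReal_poissonKernel]
  exact (isPosDefFun_exp_neg_parabolicNorm d).fourier_fourierInv_eq
    (continuous_exp_neg_parabolicNorm d) (integrable_exp_neg_parabolicNorm d)

/-- The measure with density the Poisson kernel. -/
noncomputable def poissonMeasure (d : ℕ) : Measure (E d) :=
  volume.withDensity fun x => ENNReal.ofReal (poissonKernel d x)

theorem lintegral_ofReal_poissonKernel_ne_top (d : ℕ) :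
    ∫⁻ x, ENNReal.ofReal (poissonKernel d x) ≠ ∞ :=
  (hasFiniteIntegral_iff_ofReal (Filter.Eventually.of_forall (poissonKernel_nonneg d))).1
    (integrable_poissonKernel d).2 |>.ne

instance isFiniteMeasure_poissonMeasure (d : ℕ) : IsFiniteMeasure (poissonMeasure d) :=
  isFiniteMeasure_withDensity (lintegral_ofReal_poissonKernel_ne_top d)

/-- Nonnegativity of the kernel turns the signed density into a finite measure, so that `ν` is a
difference of two finite measures. -/
theorem withDensityᵥ_poissonKernel (d : ℕ) :
    (volume : Measure (E d)).withDensityᵥ (poissonKernel d) =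
      (poissonMeasure d).toSignedMeasure := by
  have h := withDensityᵥ_toReal (μ := (volume : Measure (E d)))
    (continuous_poissonKernel d).measurable.ennreal_ofReal.aemeasurable
    (lintegral_ofReal_poissonKernel_ne_top d)
  simpa only [ENNReal.toReal_ofReal (poissonKernel_nonneg d _)] using! h

/-! ### Dilates of `ν` and their Fourier transforms -/

theorem toSignedMeasure_map {α β : Type*} [MeasurableSpace α] [MeasurableSpace β] (μ : Measure α)
    [IsFiniteMeasure μ] {g : α → β} (hg : Measurable g) :
    μ.toSignedMeasure.map g = (μ.map g).toSignedMeasure := by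
  ext s hs
  rw [VectorMeasure.map_apply _ hg hs, Measure.toSignedMeasure_apply_measurable hs,
    Measure.toSignedMeasure_apply_measurable (hg hs), map_measureReal_apply hg hs]

theorem dilate_nu (d : ℕ) (s : ℝ) :
    dilate s (nu d) = ((sigma d).map (dilation s)).toSignedMeasure -
      ((poissonMeasure d).map (dilation s)).toSignedMeasure := by
  rw [← toSignedMeasure_map _ (measurable_dilation s), ← toSignedMeasure_map _ (measurable_dilation s),
    dilate, nu, withDensityᵥ_poissonKernel]
  exact map_sub (VectorMeasure.mapₗ (R := ℝ) (dilation s)) _ _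

theorem integrable_sub_toSignedMeasure {α : Type*} [MeasurableSpace α] {A B : Measure α}
    [IsFiniteMeasure A] [IsFiniteMeasure B] {g : α → ℂ} (hA : Integrable g A)
    (hB : Integrable g B) : (A.toSignedMeasure - B.toSignedMeasure).Integrable g :=
  VectorMeasure.Integrable.sub_vectorMeasure
    (by rwa [VectorMeasure.Integrable, Measure.variation_toSignedMeasure])
    (by rwa [VectorMeasure.Integrable, Measure.variation_toSignedMeasure])

theorem conv_sub_toSignedMeasure {d : ℕ} {A B : Measure (E d)}
    [IsFiniteMeasure A] [IsFiniteMeasure B] {f : E d → ℂ} {x : E d}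
    (hA : Integrable (fun y => f (x - y)) A) (hB : Integrable (fun y => f (x - y)) B) :
    conv f (A.toSignedMeasure - B.toSignedMeasure) x = measureConv A f x - measureConv B f x := by
  rw [conv, VectorMeasure.integral_sub_vectorMeasure
    (by rwa [VectorMeasure.Integrable, Measure.variation_toSignedMeasure])
    (by rwa [VectorMeasure.Integrable, Measure.variation_toSignedMeasure]),
    VectorMeasure.integral_toSignedMeasure, VectorMeasure.integral_toSignedMeasure]
  rfl

theorem inner_dilation_left {d : ℕ} (s : ℝ) (x y : E d) :
    inner ℝ (dilation s x) y = inner ℝ x (dilation s y) := by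
  simp only [PiLp.inner_apply, dilation, RCLike.inner_apply, conj_trivial]
  exact Finset.sum_congr rfl fun i _ => by ring

/-- The dilations are diagonal, hence self-adjoint, so they pass to the frequency side unchanged. -/
theorem fourierMeasure_map_dilation {d : ℕ} (A : Measure (E d)) (s : ℝ) (ξ : E d) :
    fourierMeasure (A.map (dilation s)) ξ = fourierMeasure A (dilation s ξ) := by
  rw [fourierMeasure, integral_map (measurable_dilation s).aemeasurable
    (Continuous.aestronglyMeasurable (by fun_prop))]
  simp only [inner_dilation_left, fourierMeasure]

theorem fourierMeasure_sigma {d : ℕ} (ξ : E d) : fourierMeasure (sigma d) ξ = curveIntegral ξ := by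
  rw [fourierMeasure, sigma, integral_map (measurable_curve d).aemeasurable
    (Continuous.aestronglyMeasurable (by fun_prop)), curveIntegral]
  refine integral_congr_ae (Filter.Eventually.of_forall fun t => ?_)
  simp only [PiLp.inner_apply, curve, RCLike.inner_apply, conj_trivial, Finset.mul_sum,
    ← Finset.sum_neg_distrib]
  congr 3
  exact Finset.sum_congr rfl fun i _ => by ring

theorem fourierMeasure_poissonMeasure {d : ℕ} (ξ : E d) :
    fourierMeasure (poissonMeasure d) ξ = (Real.exp (-parabolicNorm ξ) : ℂ) := by
  rw [← congrFun (fourier_poissonKernel d) ξ, Real.fourier_eq', fourierMeasure, poissonMeasure,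
    integral_withDensity_eq_integral_toReal_smul
      (continuous_poissonKernel d).measurable.ennreal_ofReal
      (Filter.Eventually.of_forall fun _ => ENNReal.ofReal_lt_top)]
  refine integral_congr_ae (Filter.Eventually.of_forall fun y => ?_)
  simp only [ENNReal.toReal_ofReal (poissonKernel_nonneg d y), Complex.real_smul, smul_eq_mul]
  rw [mul_comm]
  congr 3
  push_cast
  ring

theorem ae_integrable_dilate_nu {d : ℕ} {f : E d → ℂ} (hf : MemLp f 2) :
    ∀ᵐ x : E d, ∀ k : ℤ,
      Integrable (fun y => f (x - y)) ((sigma d).map (dilation ((2 : ℝ) ^ k))) ∧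
        Integrable (fun y => f (x - y)) ((poissonMeasure d).map (dilation ((2 : ℝ) ^ k))) :=
  ae_all_iff.2 fun _ => (ae_integrable_sub _ hf).and (ae_integrable_sub _ hf)

theorem eLpNorm_two_sq_rpow_half {α : Type*} [MeasurableSpace α] (μ : Measure α) (G : α → ℝ≥0∞) :
    eLpNorm (fun x => G x ^ (1 / 2 : ℝ)) 2 μ = (∫⁻ x, G x ∂μ) ^ (1 / 2 : ℝ) := by
  rw [eLpNorm_eq_lintegral_rpow_enorm_toReal two_ne_zero ENNReal.ofNat_ne_top]
  congr 1
  refine lintegral_congr fun x => ?_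
  rw [enorm_eq_self, ← ENNReal.rpow_mul]
  norm_num

end ParabolicSquare

theorem mainTheorem2 :
    ∃ c : ℝ, 0 < c ∧ ∀ d : ℕ, 2 ≤ d →
      ∀ f : ParabolicSquare.E d → ℂ, MemLp f 2 volume →
        -- all the convolutions `f * ν_{2^k}` are defined almost everywhere
        (∀ᵐ x : ParabolicSquare.E d, ∀ k : ℤ,
          (ParabolicSquare.dilate ((2 : ℝ) ^ k) (ParabolicSquare.nu d)).Integrable
            (fun y => f (x - y))) ∧
        AEMeasurable (ParabolicSquare.squareFunction f) volume ∧
        eLpNorm (ParabolicSquare.squareFunction f) 2 volume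
          ≤ ENNReal.ofReal (c * Real.log d) * eLpNorm f 2 volume := by
  obtain ⟨c, hc, hbound⟩ := ParabolicSquare.exists_tsum_multiplier_sq_le
  refine ⟨c, hc, fun d hd f hf => ?_⟩
  set A : ℤ → Measure (ParabolicSquare.E d) :=
    fun k => (ParabolicSquare.sigma d).map (ParabolicSquare.dilation ((2 : ℝ) ^ k)) with hA
  set B : ℤ → Measure (ParabolicSquare.E d) :=
    fun k => (ParabolicSquare.poissonMeasure d).map (ParabolicSquare.dilation ((2 : ℝ) ^ k)) with hB
  have hint := ParabolicSquare.ae_integrable_dilate_nu hf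
  -- Integration against `ν_{2^k}` splits into the two measures only where both integrals converge,
  -- which holds for almost every `x` and all `k` at once.
  have hsq : ParabolicSquare.squareFunction f =ᵐ[volume] fun x =>
      (∑' k : ℤ, ‖ParabolicSquare.measureConv (A k) f x -
        ParabolicSquare.measureConv (B k) f x‖ₑ ^ 2) ^ (1 / 2 : ℝ) := by
    filter_upwards [hint] with x hx
    simp only [ParabolicSquare.squareFunction, ParabolicSquare.dilate_nu,
      ParabolicSquare.conv_sub_toSignedMeasure (hx _).1 (hx _).2, hA, hB]
  refine ⟨?_, ?_, ?_⟩
  · filter_upwards [hint] with x hx k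
    rw [ParabolicSquare.dilate_nu]
    exact ParabolicSquare.integrable_sub_toSignedMeasure (hx k).1 (hx k).2
  · refine AEMeasurable.congr ?_ hsq.symm
    refine (AEMeasurable.tsum fun k => ?_).pow_const _
    exact ((ParabolicSquare.aestronglyMeasurable_measureConv (A k) hf.1).sub
      (ParabolicSquare.aestronglyMeasurable_measureConv (B k) hf.1)).enorm.pow_const 2
  · have hmain := ParabolicSquare.lintegral_tsum_measureConv_sub_le A B
      (K := ENNReal.ofReal ((c * Real.log d) ^ 2)) ENNReal.ofReal_ne_top (fun ξ => by
        simp only [hA, hB, ParabolicSquare.fourierMeasure_map_dilation,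
          ParabolicSquare.fourierMeasure_sigma, ParabolicSquare.fourierMeasure_poissonMeasure]
        exact hbound d hd ξ) hf
    have hlog : 0 ≤ c * Real.log d := mul_nonneg hc.le (Real.log_natCast_nonneg d)
    rw [← ParabolicSquare.eLpNorm_two_sq, ENNReal.ofReal_pow hlog, ← mul_pow] at hmain
    rw [eLpNorm_congr_ae hsq, ParabolicSquare.eLpNorm_two_sq_rpow_half]
    refine (ENNReal.rpow_le_rpow hmain (by norm_num)).trans_eq ?_
    rw [← ENNReal.rpow_natCast, ← ENNReal.rpow_mul]
    norm_num
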